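/- Let $k$ be a field and let $(Q,\mathcal{P})$ be a thread quiver: $Q=(Q_0,Q_1,s,t)$ is a (possibly infinite) quiver and $\mathcal{P}_\alpha$ is a (possibly empty) linearly ordered set for each arrow $\alpha\in Q_1$. Its path category $\mathcal{C}$ is the $k$-linear category with object set $Q_0\sqcup\bigsqcup_{\alpha\in Q_1}\mathcal{P}_\alpha$ defined as follows. Put $s_x=t_x=x$ for $x\in Q_0$, and $s_x=s(\alpha)$, $t_x=t(\alpha)$ for $x\in\mathcal{P}_\alpha$. The space $\operatorname{Hom}_{\mathcal{C}}(x,y)$ has a basis consisting of the elements $\eta_{y,s_y}\,p\,\eta_{t_x,x}$, one for each path $p$ of $Q$ from $t_x$ to $s_y$ (where $\eta_{v,v}$ is the trivial path for $v\in Q_0$), together with one further element $\eta_{y,x}$ whenever $x\le y$ lie in the same $\mathcal{P}_\alpha$. Composition is bilinear and induced by concatenation of paths, by $\eta_{z,y}\eta_{y,x}=\eta_{z,x}$ for $x\le y\le z$ in $\mathcal{P}_\alpha$, by $\eta_{t(\alpha),y}\eta_{y,x}=\eta_{t(\alpha),x}$ and $\eta_{y,x}\eta_{x,s(\alpha)}=\eta_{y,s(\alpha)}$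 for $x\le y$ in $\mathcal{P}_\alpha$, and by $\eta_{t(\alpha),x}\eta_{x,s(\alpha)}=\alpha$ for $x\in\mathcal{P}_\alpha$; the identity of $x\in\mathcal{P}_\alpha$ is $\eta_{x,x}$. Let ${\rm rep}^{\rm pwf}\,\mathcal{C}$ be the category of covariant $k$-linear functors from $\mathcal{C}$ to finite-dimensional $k$-vector spaces, and let ${\rm rep}^{\rm fp}\,\mathcal{C}$ be its full subcategory of finitely presented representations, i.e. of those $M$ for which there is an exact sequence $$\bigoplus_{j=1}^n\operatorname{Hom}_{\mathcal{C}}(y_j,-)\to\bigoplus_{i=1}^m\operatorname{Hom}_{\mathcal{C}}(x_i,-)\to M\to 0$$ of $k$-linear functors, with $m,n$ finite. Assume that $\mathcal{C}$ is left $Q$-bounded, i.e. for each $v\in Q_0$ there are at most finitely many $w\in Q_0$ with $\operatorname{Hom}_{\mathcal{C}}(w,v)\neq 0$. Then ${\rm rep}^{\rm fp}\,\mathcal{C}$ is abelian and hereditary (that is, $\operatorname{Ext}^n(M,N)=0$ in ${\rm rep}^{\rm fp}\,\mathcal{C}$ for all $n\ge 2$ and all $M,N$), and it is closed under extensions: if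 $0\to M'\to M\to M''\to 0$ is a short exact sequence of $k$-linear functors from $\mathcal{C}$ to $k$-vector spaces with $M',M''$ in ${\rm rep}^{\rm fp}\,\mathcal{C}$, then $M$ is in ${\rm rep}^{\rm fp}\,\mathcal{C}$. -/

import Mathlib

open CategoryTheory CategoryTheory.Limits

universe u

/-- A thread quiver: a quiver `V` (possibly infinite, loops and multiple arrows allowed) together
with a (possibly empty) linearly ordered set `P α` for each arrow `α`. -/
structure ThreadQuiver (V : Type u) [Quiver.{u} V] where
  P : ∀ {a b : V}, (a ⟶ b) → Type u
  order : ∀ {a b : V} (α : a ⟶ b), LinearOrder (P α)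

namespace ThreadQuiver

variable {V : Type u} [Quiver.{u} V] (T : ThreadQuiver V)

instance {a b : V} (α : a ⟶ b) : LinearOrder (T.P α) := T.order α

/-- The points of a thread quiver: the vertices of the quiver and the elements of all the `P α`.
In other words, `P α` is completed by a minimum and a maximum, which are then identified with the
source and the target of `α`. -/
inductive Point : Type u
  | vertex (v : V) : Point
  | inner {a b : V} (α : a ⟶ b) (x : T.P α) : Point

namespace Point

variable {T}

/-- The vertex at which a path to the given point enters the closed thread of the point:
the vertex itself, respectively the source of the arrow. -/
def entry : T.Point → V
  | vertex v => v
  | @inner _ _ _ a _ _ _ => a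

/-- The vertex at which a path from the given point leaves the closed thread of the point:
the vertex itself, respectively the target of the arrow. -/
def exit : T.Point → V
  | vertex v => v
  | @inner _ _ _ _ b _ _ => b

/-- The path that traverses a point: trivial at a vertex, the arrow `α` at a point of `P α`. -/
def across : ∀ x : T.Point, Quiver.Path x.entry x.exit
  | vertex _ => Quiver.Path.nil
  | inner α _ => α.toPath

/-- The path-like elements from `x` to `y`:
* `thru p`, for a path `p` of the quiver from the exit vertex of `x` to the entry vertex of `y`.
  Between vertices this is the path `p` itself; in general it is the element
  `η_{y, s} p η_{t, x}`, where `t` is the exit vertex of `x` and `s` the entry vertex of `y`;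
* `eta h`, the element `η_{y, x}`, for `x ≤ y` in the same `P α`. -/
inductive PathLike : T.Point → T.Point → Type u
  | thru {x y : T.Point} (p : Quiver.Path x.exit y.entry) : PathLike x y
  | eta {a b : V} {α : a ⟶ b} {x y : T.P α} (h : x ≤ y) : PathLike (inner α x) (inner α y)

namespace PathLike

/-- The identity: the trivial path at a vertex, and `η_{x, x}` at a point of `P α`. -/
def id : ∀ x : T.Point, PathLike x x
  | vertex v => thru (x := vertex v) (y := vertex v) Quiver.Path.nil
  | inner _ _ => eta le_rfl

/-- Composition (in diagrammatic order) of path-like elements: concatenation of paths, with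
`η_{z, y} η_{y, x} = η_{z, x}` inside a thread and `η_{t(α), y} η_{y, s(α)} = α`. -/
def comp : ∀ {x y z : T.Point}, PathLike x y → PathLike y z → PathLike x z
  | _, y, _, thru p, thru q => thru (p.comp (y.across.comp q))
  | _, _, _, thru p, eta _ => thru p
  | _, _, _, eta _, thru q => thru q
  | _, _, _, eta h, eta h' => eta (h.trans h')

end PathLike

/-- The category of points and path-like elements. -/
instance : Category.{u} T.Point where
  Hom := PathLike
  id := PathLike.id
  comp := PathLike.comp
  id_comp := by
    intro x y f
    cases f with
    | thru p =>
      cases x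
      · exact congrArg PathLike.thru ((Quiver.Path.nil_comp _).trans (Quiver.Path.nil_comp _))
      · rfl
    | eta h => rfl
  comp_id := by
    intro x y f
    cases f with
    | thru p =>
      cases y
      · rfl
      · rfl
    | eta h => rfl
  assoc := by
    intro w x y z f g h
    cases f <;> cases g <;> cases h <;>
      first
        | rfl
        | exact congrArg PathLike.thru (by simp only [Quiver.Path.comp_assoc])

end Point

variable (k : Type u) [Field k]

/-- The path category of a thread quiver: the `k`-linear category whose objects are the points and
whose Hom spaces have the path-like elements as bases, with bilinearly extended composition. -/
abbrev PathCat : Type u := Free k T.Point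

/-- A vertex of the quiver, as an object of the path category. -/
def PathCat.vertex (v : V) : T.PathCat k := Free.of k (Point.vertex v)

/-- The path category is left `Q`-bounded: for each vertex `v` there are at most finitely many
vertices `w` with `Hom(w, v) ≠ 0`. -/
def IsLeftQBounded : Prop :=
  ∀ v : V, {w : V | Nontrivial (PathCat.vertex T k w ⟶ PathCat.vertex T k v)}.Finite

/-- Representations: covariant `k`-linear functors from the path category to `k`-vector spaces. -/
def isRep : ObjectProperty (T.PathCat k ⥤ ModuleCat.{u} k) :=
  fun M => M.Additive ∧ M.Linear k

/-- Pointwise finite-dimensional representations. -/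
def isRepPwf : ObjectProperty (T.PathCat k ⥤ ModuleCat.{u} k) :=
  fun M => T.isRep k M ∧ ∀ x, FiniteDimensional k (M.obj x)

/-- The representable projective representation `Hom(x, -)`. -/
noncomputable abbrev representable (x : T.PathCat k) : T.PathCat k ⥤ ModuleCat.{u} k :=
  (linearCoyoneda k (T.PathCat k)).obj (Opposite.op x)

/-- `M` has a finite presentation by representable projectives: there is an exact sequence
`∐ j, Hom(y j, -) ⟶ ∐ i, Hom(x i, -) ⟶ M ⟶ 0` with finite direct sums. -/
def IsFinitelyPresented (M : T.PathCat k ⥤ ModuleCat.{u} k) : Prop :=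
  ∃ (m n : ℕ) (x : Fin m → T.PathCat k) (y : Fin n → T.PathCat k)
    (f : (∐ fun j => T.representable k (y j)) ⟶ ∐ fun i => T.representable k (x i))
    (g : (∐ fun i => T.representable k (x i)) ⟶ M) (w : f ≫ g = 0),
    (ShortComplex.mk f g w).Exact ∧ Epi g

/-- Finitely presented representations, among the pointwise finite-dimensional ones. -/
def isRepFp : ObjectProperty (T.PathCat k ⥤ ModuleCat.{u} k) :=
  fun M => T.isRepPwf k M ∧ T.IsFinitelyPresented k M

/-- The category of finitely presented representations, as a full subcategory. -/
abbrev RepFp : Type (u + 1) := (T.isRepFp k).FullSubcategory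

end ThreadQuiver

/-- An abelian category is hereditary if `Ext^n(X, Y) = 0` for all objects `X`, `Y` and all
`n ≥ 2`, that is, if all its objects have projective dimension at most one (projective dimension
is defined here by the vanishing of Yoneda Ext groups). -/
def IsHereditaryCategory (A : Type*) [Category A] [Abelian A] : Prop :=
  ∀ X : A, HasProjectiveDimensionLE X 1

-- The heart of the matter is that the path category is semihereditary: the image of a morphism
-- between finite direct sums of representables is again such a sum (`IsFiniteFree.image`). This is
-- a Gröbner basis argument. The values of a free functor have a basis of monomials, well-ordered
-- compatibly with composition by their words of arrows. Composition is left cancellative, and two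
-- left factors of one path-like element are comparable for divisibility (`rigid`). So once no
-- leading monomial of a finite family divides another, the leading monomials have no common
-- multiples, and the nonzero members are independent (`exists_free_generators`).
--
-- Hence finitely presented functors have resolutions of length one by finite free functors, and
-- closure under kernels, cokernels and extensions is homological algebra in the abelian category of
-- all functors (`IsSemihereditary`). There `R` singles out the linear functors, since the Yoneda
-- lemma, and with it lifting out of free functors, concerns these. Pointwise finiteness passes to
-- subobjects, quotients and extensions.
--
-- Representables need not be pointwise finite-dimensional (one loop suffices), so these resolutions
-- may leave `RepFp`, and heredity is proved by Yoneda products instead. A class in Ext² is a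
-- product of an extension of X by K and one of K by L, the latter with an epimorphism K' → K. The
-- first is the pushout of 0 → P₁ → P₀ → X → 0 along a map P₁ → K. This map lifts to K', so the
-- extension is induced from one of X by K' (`liftsExtensions`), which lies in `RepFp` by closure
-- under extensions, and the product vanishes. Higher Ext groups follow by dimension shifting.

universe w v' u'

/-! ### Effaceability of positive Ext groups -/

open Category HomologicalComplex in
/-- A quasi-isomorphism from a complex in degrees `≤ i` to an object `X` in degree `i` is, in
degree `i`, an epimorphism onto `X`. -/
lemma CochainComplex.exists_epi_comp_eq_single_map {C : Type u'} [Category.{v'} C] [Abelian C]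
    {X : C} {K : CochainComplex C ℤ} {i : ℤ} [K.IsStrictlyLE i]
    (π : K ⟶ (single C (ComplexShape.up ℤ) i).obj X) [hπ : QuasiIso π] :
    ∃ (p : K.X i ⟶ X) (s : (single C (ComplexShape.up ℤ) i).obj (K.X i) ⟶ K), Epi p ∧
      s ≫ π = (single C (ComplexShape.up ℤ) i).map p := by
  have hd : K.d i (i + 1) = 0 := (K.isZero_of_isStrictlyLE i (i + 1) (by simp)).eq_of_tgt _ _
  let e := K.iCyclesIso i (i + 1) (by simp) hd
  -- No differential leaves degree `i`, so all of `K.X i` consists of cycles; `α` is the projection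
  -- to homology followed by the isomorphism induced by `π`, hence epi.
  let α := e.inv ≫ K.homologyπ i ≫ homologyMap π i ≫ (singleObjHomologySelfIso _ _ _).hom
  have hα : π.f i = α ≫ (singleObjXSelf (ComplexShape.up ℤ) i X).inv := by
    rw [← cancel_epi e.hom]
    dsimp only [α, e]
    rw [assoc, assoc, assoc, Iso.hom_inv_id_assoc, homologyπ_naturality_assoc,
      homologyπ_singleObjHomologySelfIso_hom_assoc, ← singleObjCyclesSelfIso_inv_iCycles,
      Iso.hom_inv_id_assoc, cyclesMap_i, iCyclesIso_hom]
  refine ⟨α, mkHomFromSingle (𝟙 (K.X i)) ?_, inferInstance, ?_⟩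
  · rintro _ rfl
    exact (K.isZero_of_isStrictlyLE i (i + 1) (by simp)).eq_of_tgt _ _
  · apply HomologicalComplex.from_single_hom_ext
    rw [comp_f, mkHomFromSingle_f, assoc, hα, id_comp]
    exact (single_map_f_self _ i α).symm

open Category DerivedCategory HomologicalComplex in
/-- A morphism in the derived category from an object in degree `i` to a complex in degrees `< i`
vanishes after pulling back along a suitable epimorphism. -/
lemma DerivedCategory.exists_epi_singleFunctor_map_comp_eq_zero {C : Type u'} [Category.{v'} C]
    [Abelian C] [HasDerivedCategory.{w} C] {X : C} {L : CochainComplex C ℤ} {i : ℤ}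
    (φ : Q.obj ((CochainComplex.singleFunctor C i).obj X) ⟶ Q.obj L)
    (n : ℤ) (hn : n < i) [L.IsStrictlyLE n] :
    ∃ (X' : C) (p : X' ⟶ X), Epi p ∧
      Q.map ((CochainComplex.singleFunctor C i).map p) ≫ φ = 0 := by
  -- A roof with apex in degrees `≤ i`. Restricted to the stalk of `K.X i`, the leg `π` becomes an
  -- epimorphism onto `X`, while `g` vanishes because `L` is zero in degree `i`.
  obtain ⟨K, _, π, h, g, rfl⟩ := right_fac_of_isStrictlyLE φ i
  have hq := h
  rw [isIso_Q_map_iff_quasiIso] at hq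
  obtain ⟨p, s, hp, hs⟩ : ∃ (p : K.X i ⟶ X) (s : (CochainComplex.singleFunctor C i).obj _ ⟶ K),
      Epi p ∧ s ≫ π = (CochainComplex.singleFunctor C i).map p :=
    CochainComplex.exists_epi_comp_eq_single_map (X := X) π (hπ := hq)
  have hsg : s ≫ g = 0 := by
    apply HomologicalComplex.from_single_hom_ext
    exact (L.isZero_of_isStrictlyLE n i hn).eq_of_tgt _ _
  refine ⟨K.X i, p, hp, ?_⟩
  rw [← hs, Q.map_comp, assoc, IsIso.hom_inv_id_assoc, ← Q.map_comp, hsg, Q.map_zero]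

open DerivedCategory in
/-- Positive Ext groups are effaceable: each class vanishes after pulling back along a suitable
epimorphism. -/
lemma CategoryTheory.Abelian.Ext.exists_epi_mk₀_comp_eq_zero {C : Type u'} [Category.{v'} C]
    [Abelian C] [HasExt.{w} C] {X Y : C} {n : ℕ} (e : Ext X Y (n + 1)) :
    ∃ (X' : C) (p : X' ⟶ X), Epi p ∧ (mk₀ p).comp e (zero_add (n + 1)) = 0 := by
  let := HasDerivedCategory.standard C
  obtain ⟨X', p, hp, h⟩ := exists_epi_singleFunctor_map_comp_eq_zero
    (L := (CochainComplex.singleFunctor C (-(n + 1))).obj Y) (i := 0) (X := X)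
    (e.hom ≫ ((singleFunctors C).shiftIso (n + 1) (-(n + 1)) 0 (by lia)).hom.app _)
    (-(n + 1)) (by lia)
  refine ⟨X', p, hp, ?_⟩
  ext
  rw [← cancel_mono (((singleFunctors C).shiftIso (n + 1) (-(n + 1)) 0 (by lia)).hom.app _),
    zero_hom]
  refine Eq.trans ?_ (h.trans Limits.zero_comp.symm)
  rw [comp_hom, mk₀_hom, ShiftedHom.mk₀_comp, Category.assoc]
  rfl

/-! ### Heredity from lifting of extensions -/

namespace CategoryTheory

open Abelian

variable {C : Type u'} [Category.{v'} C] [Abelian C]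

/-- Each Ext class of positive degree factors through the class of a short exact sequence. -/
lemma Abelian.Ext.exists_extClass_comp_eq [HasExt.{w} C] {X Y : C} {n m : ℕ} (h : 1 + n = m)
    (e : Ext X Y m) :
    ∃ (K X' : C) (f : K ⟶ X') (g : X' ⟶ X) (w : f ≫ g = 0)
      (hS : (ShortComplex.mk f g w).ShortExact) (e' : Ext K Y n), hS.extClass.comp e' h = e := by
  obtain rfl : n + 1 = m := by lia
  obtain ⟨X', p, hp, h'⟩ := Ext.exists_epi_mk₀_comp_eq_zero e
  have hS : (ShortComplex.mk (kernel.ι p) p (kernel.condition p)).ShortExact :=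
    { exact := ShortComplex.exact_kernel p }
  obtain ⟨e', he'⟩ := Ext.contravariant_sequence_exact₃ hS Y e h' h
  exact ⟨_, _, _, _, _, hS, e', he'⟩

/-- Extensions lift along epimorphisms: each extension of `X` by `K` is, for each epimorphism
`q : K' ⟶ K`, the pushout along `q` of an extension of `X` by `K'`. -/
def LiftsExtensions (X : C) : Prop :=
  ∀ ⦃K X' : C⦄ (f : K ⟶ X') (g : X' ⟶ X) (w : f ≫ g = 0), (ShortComplex.mk f g w).ShortExact →
    ∀ ⦃K' : C⦄ (q : K' ⟶ K), Epi q →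
      ∃ (W : C) (f' : K' ⟶ W) (g' : W ⟶ X) (w' : f' ≫ g' = 0) (r : W ⟶ X'),
        (ShortComplex.mk f' g' w').ShortExact ∧ f' ≫ r = q ≫ f ∧ r ≫ g = g'

/-- After splitting the class into two extensions, lifting the first along `q : K' ⟶ K` writes it as
a class with values in `K'` followed by `q`; and `q` composed with the class of the extension ending
in `q` is zero. -/
lemma LiftsExtensions.ext_two_eq_zero [HasExt.{w} C] {X : C} (hX : LiftsExtensions X) {Y : C}
    (e : Ext X Y 2) : e = 0 := by
  obtain ⟨K, X', f, g, w, hS, e', rfl⟩ := Ext.exists_extClass_comp_eq (n := 1) rfl e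
  obtain ⟨L, K', i, q, w', hT, e'', rfl⟩ := Ext.exists_extClass_comp_eq (n := 0) rfl e'
  obtain ⟨W, f', g', w'', r, hU, h₁, h₂⟩ := hX f g w hS q hT.epi_g
  have nat := ShortComplex.ShortExact.extClass_naturality hU hS
    { τ₁ := q, τ₂ := r, τ₃ := 𝟙 X, comm₁₂ := h₁.symm, comm₂₃ := by simpa using h₂ }
  rw [Ext.mk₀_id_comp] at nat
  rw [← nat, Ext.comp_assoc_of_second_deg_zero]
  erw [hT.comp_extClass_assoc]
  simp

/-- An abelian category in which extensions lift along epimorphisms is hereditary. -/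
lemma hasProjectiveDimensionLE_one_of_liftsExtensions (h : ∀ X : C, LiftsExtensions X) (X : C) :
    HasProjectiveDimensionLE X 1 := by
  let := HasExt.standard C
  rw [HasProjectiveDimensionLE, hasProjectiveDimensionLT_iff]
  intro i hi
  induction i, hi using Nat.le_induction generalizing X with
  | base => exact fun Y e ↦ (h X).ext_two_eq_zero e
  | succ i hi ih =>
    intro Y e
    obtain ⟨K, X', f, g, w, hS, e', rfl⟩ := Ext.exists_extClass_comp_eq (n := i) (by lia) e
    rw [ih K e', Ext.comp_zero]

end CategoryTheory

/-! ### Presentations relative to a semihereditary class -/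

namespace CategoryTheory.ObjectProperty

open Category

variable {C : Type u'} [Category.{v'} C] [Abelian C]

/-- `M` is the cokernel of a morphism between objects satisfying `Q`. -/
def HasPresentation (Q : ObjectProperty C) (M : C) : Prop :=
  ∃ (P₁ P₀ : C) (f : P₁ ⟶ P₀) (g : P₀ ⟶ M) (w : f ≫ g = 0),
    Q P₁ ∧ Q P₀ ∧ (ShortComplex.mk f g w).Exact ∧ Epi g

lemma hasPresentation_of_prop {Q : ObjectProperty C} {M : C} (hM : Q M) : Q.HasPresentation M := by
  refine ⟨M, M, 0, 𝟙 M, by simp, hM, hM, ?_, inferInstance⟩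
  rw [ShortComplex.exact_iff_exact_up_to_refinements]
  intro A x hx
  exact ⟨A, 𝟙 A, inferInstance, 0, by simpa using hx⟩

/-- `R` is closed under quotients, and `Q` consists of objects of `R` which are projective relative
to `R`, is closed under binary biproducts, and contains the images of all morphisms between objects
of `Q`. -/
structure IsSemihereditary (R Q : ObjectProperty C) : Prop where
  quotient : ∀ ⦃M N : C⦄ (p : M ⟶ N), Epi p → R M → R N
  le : ∀ ⦃P : C⦄, Q P → R P
  exists_lift : ∀ ⦃P M N : C⦄ (f : P ⟶ N) (p : M ⟶ N), Q P → R M → Epi p → ∃ f', f' ≫ p = f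
  biprod : ∀ ⦃P P' : C⦄, Q P → Q P' → Q (P ⊞ P')
  image : ∀ ⦃P I P' : C⦄ (p : P ⟶ I) (i : I ⟶ P'), Epi p → Mono i → Q P → Q P' → Q I

namespace IsSemihereditary

variable {R Q : ObjectProperty C} (h : R.IsSemihereditary Q)
include h

lemma prop_of_hasPresentation {M : C} (hM : Q.HasPresentation M) : R M := by
  obtain ⟨P₁, P₀, f, g, w, h₁, h₀, he, hg⟩ := hM
  exact h.quotient g hg (h.le h₀)

/-- Objects with a presentation have a resolution of length one. -/
lemma exists_shortExact {M : C} (hM : Q.HasPresentation M) :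
    ∃ (P₁ P₀ : C) (f : P₁ ⟶ P₀) (g : P₀ ⟶ M) (w : f ≫ g = 0),
      Q P₁ ∧ Q P₀ ∧ (ShortComplex.mk f g w).ShortExact := by
  obtain ⟨P₁, P₀, f, g, w, h₁, h₀, he, hg⟩ := hM
  have w' : Abelian.image.ι f ≫ g = 0 := by
    rw [← cancel_epi (Abelian.factorThruImage f)]
    simpa using w
  refine ⟨_, P₀, Abelian.image.ι f, g, w', h.image (Abelian.factorThruImage f) (Abelian.image.ι f)
    inferInstance inferInstance h₁ h₀, h₀, { exact := ?_ }⟩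
  rw [ShortComplex.exact_iff_exact_up_to_refinements]
  intro A x hx
  obtain ⟨A', π, hπ, y, hy⟩ := he.exact_up_to_refinements x hx
  exact ⟨A', π, hπ, y ≫ Abelian.factorThruImage f, by simpa using hy⟩

/-- The kernel of a morphism between objects of `Q` is in `Q`, as a direct summand. -/
lemma prop_of_kernel {K P P' : C} (i : K ⟶ P) (f : P ⟶ P') (w : i ≫ f = 0) (hi : Mono i)
    (he : (ShortComplex.mk i f w).Exact) (hP : Q P) (hP' : Q P') : Q K := by
  obtain ⟨I, p, j, hp, hj, rfl⟩ : ∃ (I : C) (p : P ⟶ I) (j : I ⟶ P'), Epi p ∧ Mono j ∧ p ≫ j = f :=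
    ⟨_, Abelian.factorThruImage f, Abelian.image.ι f, inferInstance, inferInstance, by simp⟩
  obtain ⟨s, hs⟩ := h.exists_lift (𝟙 _) p (h.image p j hp hj hP hP') (h.le hP) hp
  have hip : i ≫ p = 0 := by simpa [← cancel_mono j] using w
  have he0 : (𝟙 P - p ≫ s) ≫ p ≫ j = 0 := by
    simp [Preadditive.sub_comp, reassoc_of% hs]
  let l : P ⟶ K := he.lift (𝟙 P - p ≫ s) he0
  have hl : l ≫ i = 𝟙 P - p ≫ s := he.lift_f _ he0
  have hil : i ≫ l = 𝟙 K := by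
    rw [← cancel_mono i, assoc, hl, Preadditive.comp_sub, reassoc_of% hip]
    simp
  -- Closure of `Q` under summands is not assumed; `K` is recognised instead as the image of the
  -- endomorphism `l ≫ i` of `P`.
  have hepi : Epi l := ⟨fun a b hab ↦ by
    have := i ≫= hab
    rwa [reassoc_of% hil, reassoc_of% hil] at this⟩
  exact h.image l i hepi hi hP hP

lemma hasPresentation_biprod {M N : C} (hM : Q.HasPresentation M) (hN : Q.HasPresentation N) :
    Q.HasPresentation (M ⊞ N) := by
  obtain ⟨P₁, P₀, f, g, w, h₁, h₀, he, hg⟩ := hM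
  obtain ⟨P₁', P₀', f', g', w', h₁', h₀', he', hg'⟩ := hN
  refine ⟨_, _, biprod.map f f', biprod.map g g', by ext <;> simp [w, w'], h.biprod h₁ h₁',
    h.biprod h₀ h₀', ?_, inferInstance⟩
  rw [ShortComplex.exact_iff_exact_up_to_refinements]
  intro A x hx
  obtain ⟨A₁, π₁, hπ₁, y₁, hy₁⟩ := he.exact_up_to_refinements (x ≫ biprod.fst)
    (by simpa using hx =≫ biprod.fst)
  obtain ⟨A₂, π₂, hπ₂, y₂, hy₂⟩ := he'.exact_up_to_refinements (π₁ ≫ x ≫ biprod.snd)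
    (by simpa using π₁ ≫= hx =≫ biprod.snd)
  refine ⟨A₂, π₂ ≫ π₁, inferInstance, biprod.lift (π₂ ≫ y₁) y₂, ?_⟩
  dsimp at hy₁ hy₂ ⊢
  ext
  · simp [← hy₁]
  · simp [← hy₂]

/-- With `φ : P₀ ⟶ P₀'` lifting `u`, the object `L` is `P₀'` modulo the images of `φ` and of `P₁'`.
-/
lemma hasPresentation_of_cokernel {M N L : C} (u : M ⟶ N) (c : N ⟶ L) (w : u ≫ c = 0) (hc : Epi c)
    (he : (ShortComplex.mk u c w).Exact) (hM : Q.HasPresentation M) (hN : Q.HasPresentation N) :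
    Q.HasPresentation L := by
  obtain ⟨P₁, P₀, i, p, wp, h₁, h₀, hp⟩ := h.exists_shortExact hM
  obtain ⟨P₁', P₀', i', p', wp', h₁', h₀', hp'⟩ := h.exists_shortExact hN
  have := hp.epi_g
  have := hp'.epi_g
  dsimp at *
  obtain ⟨φ, hφ⟩ := h.exists_lift (p ≫ u) p' h₀ (h.le h₀') inferInstance
  refine ⟨P₀ ⊞ P₁', P₀', biprod.desc φ i', p' ≫ c, ?_, h.biprod h₀ h₁', h₀', ?_,
    epi_comp _ _⟩
  · ext
    · simp [reassoc_of% hφ, w]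
    · simp [reassoc_of% wp']
  rw [ShortComplex.exact_iff_exact_up_to_refinements]
  intro A x hx
  obtain ⟨A₁, π₁, hπ₁, y₁, hy₁⟩ := he.exact_up_to_refinements (x ≫ p') (by simpa using hx)
  obtain ⟨A₂, π₂, hπ₂, y₂, hy₂⟩ := surjective_up_to_refinements_of_epi p y₁
  obtain ⟨A₃, π₃, hπ₃, y₃, hy₃⟩ := hp'.exact.exact_up_to_refinements (π₂ ≫ π₁ ≫ x - y₂ ≫ φ) (by
    dsimp at *
    simp [Preadditive.sub_comp, hφ, hy₁, ← reassoc_of% hy₂])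
  refine ⟨A₃, π₃ ≫ π₂ ≫ π₁, inferInstance, biprod.lift (π₃ ≫ y₂) y₃, ?_⟩
  dsimp at *
  simp [biprod.lift_desc, ← hy₃]

/-- With `φ` lifting `u`, the kernel of `P₀ ⊞ P₁' ⟶ P₀'` projects isomorphically onto the preimage
of `K` in `P₀`, since `i'` is mono. It lies in `Q` and covers `K` with kernel `P₁`. -/
lemma hasPresentation_of_kernel {K M N : C} (k : K ⟶ M) (u : M ⟶ N) (w : k ≫ u = 0) (hk : Mono k)
    (he : (ShortComplex.mk k u w).Exact) (hM : Q.HasPresentation M) (hN : Q.HasPresentation N) :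
    Q.HasPresentation K := by
  obtain ⟨P₁, P₀, i, p, wp, h₁, h₀, hp⟩ := h.exists_shortExact hM
  obtain ⟨P₁', P₀', i', p', wp', h₁', h₀', hp'⟩ := h.exists_shortExact hN
  have := hp.epi_g
  have := hp.mono_f
  have := hp'.epi_g
  have := hp'.mono_f
  dsimp at *
  obtain ⟨φ, hφ⟩ := h.exists_lift (p ≫ u) p' h₀ (h.le h₀') inferInstance
  let ψ : P₀ ⊞ P₁' ⟶ P₀' := biprod.desc φ i'
  let z : kernel ψ ⟶ P₀ := kernel.ι ψ ≫ biprod.fst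
  have hψ : z ≫ φ + (kernel.ι ψ ≫ biprod.snd) ≫ i' = 0 := by
    rw [assoc, assoc, ← Preadditive.comp_add, ← biprod.desc_eq]
    exact kernel.condition ψ
  have hZ : Q (kernel ψ) := h.prop_of_kernel (kernel.ι ψ) ψ (kernel.condition ψ) inferInstance
    (ShortComplex.exact_kernel ψ) (h.biprod h₀ h₁') h₀'
  have hzu : (z ≫ p) ≫ u = 0 := by
    have := hψ =≫ p'
    simpa [Preadditive.add_comp, hφ, wp'] using this
  let e : kernel ψ ⟶ K := he.lift (z ≫ p) hzu
  have hek : e ≫ k = z ≫ p := he.lift_f _ hzu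
  have lift_z : ∀ {A : C} (x : A ⟶ P₀), x ≫ p ≫ u = 0 → ∃ y : A ⟶ kernel ψ, y ≫ z = x := by
    intro A x hx
    have hx' : (x ≫ φ) ≫ p' = 0 := by simpa [hφ] using hx
    let t : A ⟶ P₁' := hp'.exact.lift (x ≫ φ) hx'
    have ht : t ≫ i' = x ≫ φ := hp'.exact.lift_f (x ≫ φ) hx'
    exact ⟨kernel.lift ψ (biprod.lift x (-t)) (by simp [ψ, biprod.lift_desc, ht]), by simp [z]⟩
  have he' : Epi e := by
    rw [epi_iff_surjective_up_to_refinements]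
    intro A x
    obtain ⟨A₁, π₁, hπ₁, y₁, hy₁⟩ := surjective_up_to_refinements_of_epi p (x ≫ k)
    obtain ⟨y, hy⟩ := lift_z y₁ (by rw [← reassoc_of% hy₁, w, comp_zero, comp_zero])
    exact ⟨A₁, π₁, hπ₁, y, by rw [← cancel_mono k, assoc, assoc, hek, reassoc_of% hy, hy₁]⟩
  obtain ⟨j, hj⟩ := lift_z i (by simp [reassoc_of% wp])
  have hzm : Mono z := Preadditive.mono_of_cancel_zero _ fun {A} a ha ↦ by
    have h2 : a ≫ kernel.ι ψ ≫ biprod.snd = 0 := by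
      have := a ≫= hψ
      rw [← cancel_mono i']
      simpa [reassoc_of% ha] using this
    rw [← cancel_mono (kernel.ι ψ)]
    ext
    · simpa [z] using ha
    · simpa using h2
  refine ⟨P₁, kernel ψ, j, e, ?_, h₁, hZ, ?_, he'⟩
  · rw [← cancel_mono k, assoc, hek, reassoc_of% hj, wp, zero_comp]
  rw [ShortComplex.exact_iff_exact_up_to_refinements]
  intro A x hx
  obtain ⟨A₁, π₁, hπ₁, y₁, hy₁⟩ := hp.exact.exact_up_to_refinements (x ≫ z) (by
    dsimp at *
    rw [assoc, ← hek, reassoc_of% hx, zero_comp])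
  exact ⟨A₁, π₁, hπ₁, y₁, by dsimp at *; rw [← cancel_mono z, assoc, hy₁, assoc, hj]⟩

/-- Lifting `P₀ ⟶ X₃` to `X₂` exhibits `X₂` as the pushout of `P₀` and `X₁` under `P₁`, that is, as
a cokernel of `P₁ ⟶ X₁ ⊞ P₀`. -/
lemma hasPresentation_of_shortExact {S : ShortComplex C} (hS : S.ShortExact) (hR : R S.X₂)
    (h₁ : Q.HasPresentation S.X₁) (h₃ : Q.HasPresentation S.X₃) : Q.HasPresentation S.X₂ := by
  obtain ⟨P₁, P₀, i, p, wp, hP₁, hP₀, hp⟩ := h.exists_shortExact h₃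
  have := hp.epi_g
  have := hS.epi_g
  have := hS.mono_f
  dsimp at *
  obtain ⟨ψ, hψ⟩ := h.exists_lift p S.g hP₀ hR inferInstance
  have hw : (i ≫ ψ) ≫ S.g = 0 := by rw [assoc, hψ, wp]
  let θ : P₁ ⟶ S.X₁ := hS.exact.lift _ hw
  have hθ : θ ≫ S.f = i ≫ ψ := hS.exact.lift_f _ hw
  refine h.hasPresentation_of_cokernel (biprod.lift θ (-i)) (biprod.desc S.f ψ)
    (by simp [biprod.lift_desc, hθ]) ?_ ?_ (hasPresentation_of_prop hP₁)
    (h.hasPresentation_biprod h₁ (hasPresentation_of_prop hP₀))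
  · rw [epi_iff_surjective_up_to_refinements]
    intro A x
    obtain ⟨A₁, π₁, hπ₁, y₁, hy₁⟩ := surjective_up_to_refinements_of_epi p (x ≫ S.g)
    obtain ⟨A₂, π₂, hπ₂, y₂, hy₂⟩ := hS.exact.exact_up_to_refinements (π₁ ≫ x - y₁ ≫ ψ)
      (by simp [Preadditive.sub_comp, hψ, hy₁])
    exact ⟨A₂, π₂ ≫ π₁, inferInstance, biprod.lift y₂ (π₂ ≫ y₁), by
      simp [biprod.lift_desc, ← hy₂]⟩
  · rw [ShortComplex.exact_iff_exact_up_to_refinements]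
    intro A x hx
    dsimp at *
    have hx' : x ≫ biprod.fst ≫ S.f + x ≫ biprod.snd ≫ ψ = 0 := by
      rw [← Preadditive.comp_add, ← biprod.desc_eq]
      exact hx
    obtain ⟨A₁, π₁, hπ₁, y₁, hy₁⟩ := hp.exact.exact_up_to_refinements (x ≫ biprod.snd) (by
      simpa [hψ] using hx' =≫ S.g)
    dsimp at *
    refine ⟨A₁, π₁, hπ₁, -y₁, ?_⟩
    ext
    · rw [← cancel_mono S.f]
      have := π₁ ≫= hx'
      rw [comp_zero, Preadditive.comp_add, reassoc_of% hy₁, ← hθ] at this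
      simpa [neg_eq_iff_add_eq_zero] using eq_neg_of_add_eq_zero_left this
    · simp [hy₁]

/-- The given extension is classified by a map `b : P₁ ⟶ K`. Relative projectivity of `P₁` lifts `b`
through `q`, and the pushout along the lift is the new extension; it is in `R` as a quotient of `P₀
⊞ K'`. -/
lemma exists_shortExact_of_epi {X K X' K' : C} (f : K ⟶ X') (g : X' ⟶ X) (w : f ≫ g = 0)
    (hS : (ShortComplex.mk f g w).ShortExact) (q : K' ⟶ K) (hq : Epi q) (hX : Q.HasPresentation X)
    (hX' : R X') (hK' : R K') (hR : ∀ ⦃M N : C⦄, R M → R N → R (M ⊞ N)) :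
    ∃ (W : C) (f' : K' ⟶ W) (g' : W ⟶ X) (w' : f' ≫ g' = 0) (r : W ⟶ X'),
      R W ∧ (ShortComplex.mk f' g' w').ShortExact ∧ f' ≫ r = q ≫ f ∧ r ≫ g = g' := by
  obtain ⟨P₁, P₀, i, p, wp, hP₁, hP₀, hp⟩ := h.exists_shortExact hX
  have := hp.epi_g
  have := hp.mono_f
  have := hS.epi_g
  have := hS.mono_f
  dsimp at *
  obtain ⟨a, ha⟩ := h.exists_lift p g hP₀ hX' inferInstance
  have hw : (i ≫ a) ≫ g = 0 := by rw [assoc, ha, wp]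
  let b : P₁ ⟶ K := hS.exact.lift _ hw
  have hb : b ≫ f = i ≫ a := hS.exact.lift_f _ hw
  obtain ⟨c, hc⟩ := h.exists_lift b q hP₁ hK' hq
  have hepi : Epi (biprod.desc (pushout.inl i c) (pushout.inr i c)) := ⟨fun s t hst ↦ by
    apply pushout.hom_ext
    · simpa using biprod.inl ≫= hst
    · simpa using biprod.inr ≫= hst⟩
  obtain ⟨g', hl, hr⟩ : ∃ g' : pushout i c ⟶ X, pushout.inl i c ≫ g' = p ∧
      pushout.inr i c ≫ g' = 0 :=
    ⟨pushout.desc p 0 (by rw [wp, comp_zero]), pushout.inl_desc _ _ _, pushout.inr_desc _ _ _⟩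
  obtain ⟨r, hrl, hrr⟩ : ∃ r : pushout i c ⟶ X', pushout.inl i c ≫ r = a ∧
      pushout.inr i c ≫ r = q ≫ f :=
    ⟨pushout.desc a (q ≫ f) (by rw [← hb, ← hc, assoc]), pushout.inl_desc _ _ _,
      pushout.inr_desc _ _ _⟩
  refine ⟨pushout i c, pushout.inr i c, g', hr, r, h.quotient _ hepi (hR (h.le hP₀) hK'), ?_,
    hrr, by apply pushout.hom_ext <;> simp [hl, hr, reassoc_of% hrl, reassoc_of% hrr, ha, w]⟩
  have hepi' : Epi g' :=
    ⟨fun s t hst ↦ by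
      have := pushout.inl i c ≫= hst
      rwa [reassoc_of% hl, reassoc_of% hl, cancel_epi] at this⟩
  have hmono : Mono (pushout.inr i c) := inferInstance
  -- Maps out of the pushout that kill `K'` are maps out of `P₀` that kill `P₁`, hence maps out of
  -- `X`; so `g'` is the cokernel of `K'`.
  have hdesc : ∀ {T : C} (t : pushout i c ⟶ T), pushout.inr i c ≫ t = 0 → ∃ t', g' ≫ t' = t := by
    intro T t ht
    have ht' : i ≫ pushout.inl i c ≫ t = 0 := by rw [pushout.condition_assoc, ht, comp_zero]
    have hd : p ≫ hp.exact.desc (pushout.inl i c ≫ t) ht' = pushout.inl i c ≫ t :=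
      hp.exact.g_desc _ ht'
    exact ⟨hp.exact.desc _ ht', by
      apply pushout.hom_ext
      · rw [reassoc_of% hl, hd]
      · rw [reassoc_of% hr, ht, zero_comp]⟩
  refine { exact := ?_, mono_f := hmono, epi_g := hepi' }
  choose d hd using @hdesc
  exact ShortComplex.exact_of_g_is_cokernel _ (CokernelCofork.IsColimit.ofπ _ _
    (fun t ht ↦ d t ht) (fun t ht ↦ hd t ht)
    (fun t ht m hm ↦ by rw [← cancel_epi g', hd]; exact hm))

end IsSemihereditary
end CategoryTheory.ObjectProperty

/-! ### Leading monomials and free generators -/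

/-- The formal monomials in the variables `x i` at an object `z`: the basis elements of the value
at `z` of the direct sum of the free modules on the `x i`. -/
abbrev Monomial {D : Type*} [Category D] {ι : Type*} (x : ι → D) (z : D) := Σ i, (x i ⟶ z)

namespace Monomial

variable {D : Type*} [Category D] {ι : Type*} {x : ι → D}

/-- The action of morphisms on monomials. -/
def push {y z : D} (c : y ⟶ z) (s : Monomial x y) : Monomial x z := ⟨s.1, s.2 ≫ c⟩

@[simp] lemma push_id {y : D} (s : Monomial x y) : s.push (𝟙 y) = s := by simp [push]

lemma push_comp {w y z : D} (c : w ⟶ y) (d : y ⟶ z) (s : Monomial x w) :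
    s.push (c ≫ d) = (s.push c).push d := by simp [push]

variable (k : Type*) [Field k]

/-- The action of morphisms on linear combinations of monomials. -/
noncomputable def act {y z : D} (c : y ⟶ z) : (Monomial x y →₀ k) →ₗ[k] (Monomial x z →₀ k) :=
  Finsupp.lmapDomain k k (push c)

@[simp] lemma act_single {y z : D} (c : y ⟶ z) (s : Monomial x y) (a : k) :
    act k c (Finsupp.single s a) = Finsupp.single (s.push c) a :=
  Finsupp.mapDomain_single

@[simp] lemma act_id {y : D} (a : Monomial x y →₀ k) : act k (𝟙 y) a = a := by
  induction a using Finsupp.induction_linear with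
  | zero => simp
  | add a b ha hb => simp [ha, hb]
  | single s a => simp

lemma act_comp {w y z : D} (c : w ⟶ y) (d : y ⟶ z) (a : Monomial x w →₀ k) :
    act k (c ≫ d) a = act k d (act k c a) := by
  induction a using Finsupp.induction_linear with
  | zero => simp
  | add a b ha hb => simp [ha, hb]
  | single s a => simp [push_comp]

variable {k}

/-- The map sending a linear combination of monomials in the variables `y j` to its value at the
elements `g j`. -/
noncomputable def comb {κ : Type*} {y : κ → D} (g : ∀ j, Monomial x (y j) →₀ k) (z : D) :
    (Monomial y z →₀ k) →ₗ[k] (Monomial x z →₀ k) :=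
  Finsupp.linearCombination k fun s ↦ act k s.2 (g s.1)

@[simp] lemma comb_single {κ : Type*} {y : κ → D} (g : ∀ j, Monomial x (y j) →₀ k) (z : D)
    (s : Monomial y z) (a : k) : comb g z (Finsupp.single s a) = a • act k s.2 (g s.1) := by
  simp [comb]

lemma act_mem_range_comb {κ : Type*} {y : κ → D} (g : ∀ j, Monomial x (y j) →₀ k) {z : D} (j : κ)
    (c : y j ⟶ z) : act k c (g j) ∈ LinearMap.range (comb g z) :=
  ⟨Finsupp.single ⟨j, c⟩ 1, by simp⟩

lemma range_comb_le_iff {κ : Type*} {y : κ → D} (g : ∀ j, Monomial x (y j) →₀ k) (z : D)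
    (N : Submodule k (Monomial x z →₀ k)) :
    LinearMap.range (comb g z) ≤ N ↔ ∀ j (c : y j ⟶ z), act k c (g j) ∈ N := by
  rw [comb, Finsupp.range_linearCombination, Submodule.span_le]
  constructor
  · rintro h j c
    exact h ⟨⟨j, c⟩, rfl⟩
  · rintro h _ ⟨⟨j, c⟩, rfl⟩
    exact h j c

/-- The submodules generated by a family do not change when its zero members are removed. -/
lemma range_comb_subtype_ne_zero {κ : Type*} {y : κ → D} (g : ∀ j, Monomial x (y j) →₀ k) (z : D) :
    LinearMap.range (comb (fun j : {j // g j ≠ 0} ↦ g j) z) = LinearMap.range (comb g z) := by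
  apply le_antisymm
  · rw [range_comb_le_iff]
    exact fun j c ↦ act_mem_range_comb g j.1 c
  · rw [range_comb_le_iff]
    intro j c
    by_cases hj : g j = 0
    · simp [hj]
    · exact act_mem_range_comb (fun j : {j // g j ≠ 0} ↦ g j) ⟨j, hj⟩ c

/-- An admissible order on monomials: an injective map to a linearly ordered type such that the
action of morphisms is strictly monotone. -/
structure AdmissibleOrder (x : ι → D) (W : Type*) [LinearOrder W] where
  code : ∀ {z : D}, Monomial x z → W
  injective : ∀ z, Function.Injective (code (z := z))
  push_lt_push : ∀ {y z : D} (c : y ⟶ z) {s t : Monomial x y}, code s < code t →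
    code (s.push c) < code (t.push c)

namespace AdmissibleOrder

variable {W : Type*} [LinearOrder W] (o : AdmissibleOrder x W)

lemma push_le_push {y z : D} (c : y ⟶ z) {s t : Monomial x y} (h : o.code s ≤ o.code t) :
    o.code (s.push c) ≤ o.code (t.push c) := by
  rcases h.lt_or_eq with h | h
  · exact (o.push_lt_push c h).le
  · rw [o.injective _ h]

/-- The code of the leading monomial. -/
noncomputable def lead {z : D} (a : Monomial x z →₀ k) : WithBot W :=
  a.support.sup fun s ↦ (o.code s : WithBot W)

lemma le_lead {z : D} {a : Monomial x z →₀ k} {s : Monomial x z} (hs : a s ≠ 0) :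
    (o.code s : WithBot W) ≤ o.lead a :=
  Finset.le_sup (f := fun s ↦ (o.code s : WithBot W)) (Finsupp.mem_support_iff.2 hs)

lemma exists_lead_eq {z : D} {a : Monomial x z →₀ k} (ha : a ≠ 0) :
    ∃ s, a s ≠ 0 ∧ o.lead a = o.code s := by
  obtain ⟨s, hs, h⟩ := Finset.exists_mem_eq_sup a.support (Finsupp.support_nonempty_iff.2 ha)
    (fun s ↦ (o.code s : WithBot W))
  exact ⟨s, Finsupp.mem_support_iff.1 hs, h⟩

lemma lead_lt {z : D} {a : Monomial x z →₀ k} {s : Monomial x z}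
    (h : ∀ t, a t ≠ 0 → o.code t < o.code s) : o.lead a < o.code s := by
  rw [lead, Finset.sup_lt_iff (WithBot.bot_lt_coe _)]
  intro t ht
  exact WithBot.coe_lt_coe.2 (h t (Finsupp.mem_support_iff.1 ht))

lemma exists_of_act_ne_zero {y z : D} (c : y ⟶ z) {a : Monomial x y →₀ k} {t : Monomial x z}
    (ht : act k c a t ≠ 0) : ∃ s, a s ≠ 0 ∧ s.push c = t := by
  classical
  have := Finsupp.mapDomain_support (Finsupp.mem_support_iff.2 ht)
  obtain ⟨s, hs, rfl⟩ := Finset.mem_image.1 this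
  exact ⟨s, Finsupp.mem_support_iff.1 hs, rfl⟩

include o in
-- Strict monotonicity for a total order forces injectivity. Right cancellation thus comes with the
-- order; left cancellation is a separate hypothesis below.
lemma push_injective {y z : D} (c : y ⟶ z) : Function.Injective (push (x := x) c) := by
  intro s t h
  apply o.injective
  rcases lt_trichotomy (o.code s) (o.code t) with h' | h' | h'
  · exact absurd (o.push_lt_push c h') (by rw [h]; exact lt_irrefl _)
  · exact h'
  · exact absurd (o.push_lt_push c h') (by rw [h]; exact lt_irrefl _)

include o in
lemma act_push {y z : D} (c : y ⟶ z) (a : Monomial x y →₀ k) (s : Monomial x y) :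
    act k c a (s.push c) = a s :=
  Finsupp.mapDomain_apply (o.push_injective c) a s

/-- Subtracting a suitable multiple of `b` from `a` cancels the leading monomial of `a`, if the
latter is a multiple of the leading monomial of `b`. -/
lemma exists_lead_sub_lt {y z : D} (c : y ⟶ z) {a : Monomial x z →₀ k} {b : Monomial x y →₀ k}
    {s : Monomial x y} (ha : o.lead a = o.code (s.push c)) (hbs : b s ≠ 0)
    (hb : o.lead b = o.code s) : ∃ r : k, o.lead (a - r • act k c b) < o.lead a := by
  -- The ratio of the two leading coefficients.
  refine ⟨a (s.push c) * (b s)⁻¹, ?_⟩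
  rw [ha]
  apply o.lead_lt
  intro t ht
  have hne : t ≠ s.push c := by
    rintro rfl
    simp [o.act_push, hbs] at ht
  refine lt_of_le_of_ne ?_ fun h ↦ hne (o.injective _ h)
  by_cases hat : a t = 0
  · have : act k c b t ≠ 0 := fun h ↦ ht (by simp [hat, h])
    obtain ⟨t', ht', rfl⟩ := exists_of_act_ne_zero c this
    apply o.push_le_push
    exact WithBot.coe_le_coe.1 (hb ▸ o.le_lead ht')
  · exact WithBot.coe_le_coe.1 (ha ▸ o.le_lead hat)

/-- A family of nonzero elements whose leading monomials have no common multiples is free. -/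
lemma comb_injective {κ : Type*} {y : κ → D} (h : ∀ j, Monomial x (y j) →₀ k)
    (s : ∀ j, Monomial x (y j)) (hs : ∀ j, h j (s j) ≠ 0) (hl : ∀ j, o.lead (h j) = o.code (s j))
    (cancel : ∀ {a b c : D} (f : a ⟶ b) (g g' : b ⟶ c), f ≫ g = f ≫ g' → g = g')
    (disj : ∀ {i j : κ} {z : D} (c : y i ⟶ z) (d : y j ⟶ z),
      (s i).push c = (s j).push d → i = j) (z : D) :
    Function.Injective (comb h z) := by
  classical
  rw [← LinearMap.ker_eq_bot, LinearMap.ker_eq_bot']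
  intro a ha
  by_contra hne
  let top : Monomial y z → Monomial x z := fun m ↦ (s m.1).push m.2
  have top_inj : Function.Injective top := by
    rintro ⟨i, c⟩ ⟨j, d⟩ hij
    obtain rfl := disj c d hij
    have : (s i).2 ≫ c = (s i).2 ≫ d := by simpa [top, push] using hij
    rw [cancel _ _ _ this]
  -- The terms of the relation have pairwise distinct leading monomials, so the largest of these
  -- cannot cancel.
  obtain ⟨m, hm, hmax⟩ := Finset.exists_max_image a.support (fun m ↦ o.code (top m))
    (Finsupp.support_nonempty_iff.2 hne)
  have key : comb h z a (top m) = a m * h m.1 (s m.1) := by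
    rw [comb, Finsupp.linearCombination_apply, Finsupp.sum, Finsupp.finsetSum_apply,
      Finset.sum_eq_single m]
    · simp [top, o.act_push]
    · intro m' hm' hne'
      rw [Finsupp.smul_apply, smul_eq_mul, mul_eq_zero]
      right
      by_contra h0
      obtain ⟨t, ht, htm⟩ := exists_of_act_ne_zero _ h0
      have h1 : o.code t ≤ o.code (s m'.1) := WithBot.coe_le_coe.1 (hl m'.1 ▸ o.le_lead ht)
      have h2 : t ≠ s m'.1 := by
        rintro rfl
        exact hne' (top_inj htm)
      have h3 := o.push_lt_push m'.2 (lt_of_le_of_ne h1 fun h ↦ h2 (o.injective _ h))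
      rw [htm] at h3
      exact absurd (hmax m' hm') (not_le.2 h3)
    · intro hm'
      exact absurd hm hm'
  rw [ha, Finsupp.zero_apply] at key
  exact mul_ne_zero (Finsupp.mem_support_iff.1 hm) (hs m.1) key.symm

include o in
/-- Finitely generated submodules of free modules are free: over a left cancellative category in
which two morphisms with a common multiple are comparable for divisibility, and for a well-founded
admissible order, each finite family may be replaced by one generating the same submodules whose
nonzero members are free. -/
theorem exists_free_generators [WellFoundedLT W] {κ : Type*} [Finite κ] {y : κ → D}
    (cancel : ∀ {a b c : D} (f : a ⟶ b) (g g' : b ⟶ c), f ≫ g = f ≫ g' → g = g')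
    (rigid : ∀ {a b b' c : D} (f : a ⟶ b) (f' : a ⟶ b') (g : b ⟶ c) (g' : b' ⟶ c),
      f ≫ g = f' ≫ g' → (∃ d, f ≫ d = f') ∨ (∃ d, f' ≫ d = f))
    (g : ∀ j, Monomial x (y j) →₀ k) :
    ∃ h : ∀ j, Monomial x (y j) →₀ k,
      (∀ z, LinearMap.range (comb h z) = LinearMap.range (comb g z)) ∧
      ∀ z, Function.Injective (comb (fun j : {j // h j ≠ 0} ↦ h j) z) := by
  classical
  let H : Set (∀ j, Monomial x (y j) →₀ k) :=
    {h | ∀ z, LinearMap.range (comb h z) = LinearMap.range (comb g z)}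
  -- Members reduced to zero stay in the family with lead `⊥`, so the index set is fixed and
  -- minimality refers to the product order, well-founded because `κ` is finite.
  let leads : (∀ j, Monomial x (y j) →₀ k) → κ → WithBot W := fun h j ↦ o.lead (h j)
  have wf : WellFounded (InvImage (· < ·) leads) := InvImage.wf _ wellFounded_lt
  obtain ⟨h, hH, hmin⟩ := wf.has_min H ⟨g, fun _ ↦ rfl⟩
  -- Otherwise subtracting a multiple of `h i` would lower the lead of `h j` and no other, without
  -- changing the generated submodules.
  have reduced : ∀ {i j : κ} (c : y i ⟶ y j) (s : Monomial x (y i)), i ≠ j → h i s ≠ 0 →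
      o.lead (h i) = o.code s → o.lead (h j) ≠ o.code (s.push c) := by
    intro i j c s hij hs hi hj
    obtain ⟨r, hr⟩ := o.exists_lead_sub_lt c hj hs hi
    let h' : ∀ j, Monomial x (y j) →₀ k := Function.update h j (h j - r • act k c (h i))
    have hj' : h' j = h j - r • act k c (h i) := Function.update_self ..
    have hne : ∀ l, l ≠ j → h' l = h l := fun l hl ↦ Function.update_of_ne hl ..
    refine hmin h' (fun z ↦ ?_) (Pi.lt_def.2 ⟨fun l ↦ ?_, j, ?_⟩)
    · rw [← hH z]
      apply le_antisymm
      · rw [range_comb_le_iff]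
        intro l d
        by_cases hl : l = j
        · subst hl
          rw [hj', map_sub, map_smul, ← act_comp]
          exact sub_mem (act_mem_range_comb h l d)
            (Submodule.smul_mem _ _ (act_mem_range_comb h i (c ≫ d)))
        · rw [hne l hl]
          exact act_mem_range_comb h l d
      · rw [range_comb_le_iff]
        intro l d
        by_cases hl : l = j
        · subst hl
          have : act k d (h l) = act k d (h' l) + r • act k (c ≫ d) (h' i) := by
            rw [hj', hne i hij, act_comp]
            simp
          rw [this]
          exact add_mem (act_mem_range_comb h' l d)
            (Submodule.smul_mem _ _ (act_mem_range_comb h' i (c ≫ d)))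
        · rw [← hne l hl]
          exact act_mem_range_comb h' l d
    · by_cases hl : l = j
      · subst hl
        simpa only [leads, hj'] using hr.le
      · simp only [leads, hne l hl, le_refl]
    · simpa only [leads, hj'] using hr
  refine ⟨h, hH, fun z ↦ ?_⟩
  choose s hs hl using fun j : {j // h j ≠ 0} ↦ o.exists_lead_eq j.2
  refine o.comb_injective _ s hs hl cancel ?_ z
  intro i j z c d hcd
  obtain ⟨hij, hcd'⟩ := Sigma.mk.inj_iff.1 hcd
  have main : ∀ {i j : {j // h j ≠ 0}} (e : y i ⟶ y j), (s i).push e = s j → i = j := by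
    intro i j e he
    by_contra hne
    exact reduced e (s i) (fun h ↦ hne (Subtype.ext h)) (hs i) (hl i) (by rw [he, hl j])
  generalize hsi : s i = si at *
  generalize hsj : s j = sj at *
  obtain ⟨ai, fi⟩ := si
  obtain ⟨aj, fj⟩ := sj
  obtain rfl : ai = aj := hij
  -- A common multiple makes one leading monomial a multiple of the other, which reducedness forbids
  -- for distinct indices.
  rcases rigid fi fj c d (eq_of_heq hcd') with ⟨e, he⟩ | ⟨e, he⟩
  · exact main e (by rw [hsi, hsj, ← he]; rfl)
  · exact (main e (by rw [hsi, hsj, ← he]; rfl)).symm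

end AdmissibleOrder
end Monomial

/-! ### Words of paths and the shortlex order -/

namespace Quiver.Path

variable {V : Type*} [Quiver V]

/-- The list of the arrows of a path. -/
def arrows {a : V} : ∀ {b : V}, Path a b → List (Σ a b : V, (a ⟶ b))
  | _, nil => []
  | _, cons p e => arrows p ++ [⟨_, _, e⟩]

@[simp] lemma arrows_comp {a b c : V} (p : Path a b) (q : Path b c) :
    (p.comp q).arrows = p.arrows ++ q.arrows := by
  induction q with
  | nil => simp [arrows]
  | cons q e ih => simp [arrows, ih]

lemma arrows_injective {a b : V} : Function.Injective (arrows : Path a b → _) := by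
  intro p q h
  induction p with
  | nil =>
    cases q with
    | nil => rfl
    | cons q e => simp [arrows] at h
  | cons p e ih =>
    cases q with
    | nil => simp [arrows] at h
    | cons q e' =>
      simp only [arrows, List.append_singleton_inj] at h
      obtain ⟨h, h'⟩ := h
      obtain ⟨rfl, h'⟩ := Sigma.mk.inj_iff.1 h'
      obtain ⟨_, h'⟩ := Sigma.mk.inj_iff.1 (eq_of_heq h')
      rw [ih h, eq_of_heq h']

end Quiver.Path

namespace List

/-- Equal lengths exclude that `s` is a proper prefix of `t`, the case in which appending can
reverse the order. Shortlex compares lengths first for this reason. -/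
lemma Lex.append_right_of_length_eq {α : Type*} {r : α → α → Prop} {s t : List α} (h : Lex r s t)
    (hl : s.length = t.length) (w : List α) : Lex r (s ++ w) (t ++ w) := by
  induction h with
  | nil => simp at hl
  | cons _ ih => exact .cons (ih (by simpa using hl))
  | rel h => exact .rel h

lemma Shortlex.append_append {α : Type*} {r : α → α → Prop} {s t : List α} (h : Shortlex r s t)
    (w : List α) : Shortlex r (s ++ w) (t ++ w) := by
  rw [shortlex_def] at h ⊢
  rcases h with h | ⟨h, h'⟩
  · exact .inl (by simpa using h)
  · exact .inr ⟨by simpa using h, h'.append_right_of_length_eq h w⟩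

instance Shortlex.instIsWellOrder {α : Type*} (r : α → α → Prop) [IsWellOrder α r] :
    IsWellOrder (List α) (Shortlex r) where
  wf := Shortlex.wf IsWellFounded.wf

end List

/-! ### Divisibility and order of path-like elements -/

namespace ThreadQuiver.Point

variable {V : Type u} [Quiver.{u} V] {T : ThreadQuiver V}

open PathLike

/-- The arrows which are completed along a path-like element. -/
def PathLike.word : ∀ {x y : T.Point}, PathLike x y → List (Σ a b : V, (a ⟶ b))
  | _, y, thru p => p.arrows ++ y.across.arrows
  | _, _, eta _ => []

/-- An arrow is counted as soon as a point of its thread is reached from outside; moving on inside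
the thread, or leaving it at the target, adds no letter. -/
lemma word_comp {x y z : T.Point} (f : PathLike x y) (g : PathLike y z) :
    (f.comp g).word = f.word ++ g.word := by
  cases f <;> cases g <;> simp [PathLike.comp, PathLike.word] <;> rfl

/-- A `thru` ending at an inner point has a nonempty word, which separates it from the single
possible `eta`, whose word is empty. -/
lemma word_injective (x y : T.Point) : Function.Injective (PathLike.word : PathLike x y → _) := by
  intro f g h
  cases f with
  | thru p =>
    cases g with
    | thru q =>
      simp only [PathLike.word, List.append_cancel_right_eq] at h
      rw [Quiver.Path.arrows_injective h]
    | eta _ => simp [PathLike.word, across, Quiver.Hom.toPath, Quiver.Path.arrows] at h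
  | eta _ =>
    cases g with
    | thru q => simp [PathLike.word, across, Quiver.Hom.toPath, Quiver.Path.arrows] at h
    | eta _ => rfl

lemma comp_left_cancel {x y z : T.Point} (f : PathLike x y) (g g' : PathLike y z)
    (h : f.comp g = f.comp g') : g = g' := by
  apply word_injective
  have := congrArg PathLike.word h
  rwa [word_comp, word_comp, List.append_cancel_left_eq] at this

/-- The two arrows must agree, so both points lie on one thread, where the linear order compares
them. -/
lemma thru_inner_rigid {x : T.Point} {a a' b : V} (p : Quiver.Path x.exit a) (α : a ⟶ b)
    (s : T.P α) (p' : Quiver.Path x.exit a') (α' : a' ⟶ b) (s' : T.P α')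
    (h : p.cons α = p'.cons α') :
    (∃ d, PathLike.comp (thru (y := inner α s) p) d = thru (y := inner α' s') p') ∨
      ∃ d, PathLike.comp (thru (y := inner α' s') p') d = thru (y := inner α s) p := by
  cases h
  rcases le_total s s' with hs | hs
  · exact .inl ⟨eta hs, rfl⟩
  · exact .inr ⟨eta hs, rfl⟩

/-- Divisibility of path-like elements. -/
lemma thru_rigid {x y y' : T.Point} (p : Quiver.Path x.exit y.entry)
    (p' : Quiver.Path x.exit y'.entry) {v : V} (q : Quiver.Path y.exit v)
    (q' : Quiver.Path y'.exit v)
    (h : p.comp (y.across.comp q) = p'.comp (y'.across.comp q')) :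
    (∃ d : y ⟶ y', PathLike.comp (thru p) d = thru p') ∨
      ∃ d : y' ⟶ y, PathLike.comp (thru p') d = thru p := by
  -- Common last arrows are stripped until a remainder is trivial. The factor with trivial remainder
  -- is then a multiple of the other, unless both end inside one thread, where the order decides.
  induction q with
  | nil =>
    cases y with
    | vertex v => exact .inr ⟨thru q', congrArg thru h.symm⟩
    | inner α s =>
      cases q' with
      | nil =>
        cases y' with
        | vertex v' => exact .inl ⟨thru (x := inner α s) .nil, congrArg thru h⟩
        | inner α' s' =>
          exact thru_inner_rigid p α s p' α' s' h
      | cons q' e =>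
        simp only [across, Quiver.Hom.toPath, Quiver.Path.comp] at h
        cases h
        exact .inr ⟨thru q', rfl⟩
  | cons q e ih =>
    cases q' with
    | nil =>
      cases y' with
      | vertex v' => exact .inl ⟨thru (q.cons e), congrArg thru h⟩
      | inner α' s' =>
        simp only [across, Quiver.Hom.toPath, Quiver.Path.comp] at h
        cases h
        exact .inl ⟨thru q, rfl⟩
    | cons q' e' =>
      simp only [Quiver.Path.comp] at h
      obtain ⟨rfl, h₁, h₂⟩ := Quiver.Path.cons.inj h
      exact ih q' (eq_of_heq h₁)

/-- An `eta` out of `x` left-divides every `thru` out of `x`, and two `eta`s are compared by the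
linear order; what remains is a comparison of paths. -/
lemma rigid {x y y' z : T.Point} (f : PathLike x y) (f' : PathLike x y') (g : PathLike y z)
    (g' : PathLike y' z) (h : f.comp g = f'.comp g') :
    (∃ d, f.comp d = f') ∨ (∃ d, f'.comp d = f) := by
  cases f with
  | thru p =>
    cases f' with
    | eta hs' => exact .inr ⟨thru p, rfl⟩
    | thru p' =>
      cases g with
      | @eta a b α s t hs =>
        cases g' with
        | @eta _ _ _ s' _ hs' =>
          cases h
          rcases le_total s s' with hs | hs
          · exact .inl ⟨eta hs, rfl⟩
          · exact .inr ⟨eta hs, rfl⟩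
        | thru q' =>
          exact .inr ⟨thru q', congrArg thru (thru.inj h).symm⟩
      | thru q =>
        cases g' with
        | eta hs' =>
          have h' : thru _ = thru _ := h
          have h'' := thru.inj h'
          exact .inl ⟨thru q, congrArg thru h''⟩
        | thru q' => exact thru_rigid p p' q q' (thru.inj h)
  | @eta a b α r s hs =>
    cases f' with
    | thru p' =>
      exact .inl ⟨thru p', rfl⟩
    | @eta _ _ _ _ s' hs' =>
      rcases le_total s s' with hs | hs
      · exact .inl ⟨eta hs, rfl⟩
      · exact .inr ⟨eta hs, rfl⟩

/-- Monomials over a thread quiver are well-ordered compatibly with composition: first by their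
words, for the shortlex order, then by their variables. -/
lemma exists_admissibleOrder {ι : Type} (x : ι → T.Point) :
    ∃ (W : Type u) (_ : LinearOrder W) (_ : WellFoundedLT W),
      Nonempty (Monomial.AdmissibleOrder x W) := by
  let r : List (Σ a b : V, (a ⟶ b)) × ι → List (Σ a b : V, (a ⟶ b)) × ι → Prop :=
    Prod.Lex (List.Shortlex WellOrderingRel) WellOrderingRel
  have hr : IsWellOrder _ r := inferInstance
  refine ⟨_, IsWellOrder.linearOrder r, ⟨hr.wf⟩, ⟨@Monomial.AdmissibleOrder.mk _ _ _ x _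
    (IsWellOrder.linearOrder r) (fun s ↦ (PathLike.word s.2, s.1)) ?_ ?_⟩⟩
  · rintro z ⟨i, f⟩ ⟨j, g⟩ h
    obtain ⟨h, rfl⟩ := Prod.mk.inj h
    exact congrArg (Sigma.mk i) (word_injective _ _ h)
  · rintro y z c ⟨i, f⟩ ⟨j, g⟩ h
    change r _ _ at h
    change r _ _
    rcases Prod.lex_def.1 h with h | ⟨h, h'⟩
    · refine Prod.Lex.left _ _ ?_
      dsimp [Monomial.push]
      rw [show PathLike.word (f ≫ c) = _ from word_comp f c,
        show PathLike.word (g ≫ c) = _ from word_comp g c]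
      exact h.append_append _
    · refine Prod.lex_def.2 (.inr ⟨?_, h'⟩)
      dsimp [Monomial.push] at h ⊢
      rw [show PathLike.word (f ≫ c) = _ from word_comp f c,
        show PathLike.word (g ≫ c) = _ from word_comp g c, h]

end ThreadQuiver.Point

/-! ### Linear and free functors on a linearized category -/

namespace CategoryTheory.Free

variable {k : Type u} [Field k] {D : Type u} [Category.{u} D]

/-- The basis of the morphisms of the linearization of a category. -/
noncomputable def emb {y z : D} (c : y ⟶ z) : Free.of k y ⟶ Free.of k z :=
  (Free.embedding k D).map c

lemma emb_id (z : D) : (emb (𝟙 z) : Free.of k z ⟶ Free.of k z) = 𝟙 _ :=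
  (Free.embedding k D).map_id z

lemma emb_comp {w y z : D} (c : w ⟶ y) (d : y ⟶ z) :
    (emb (c ≫ d) : Free.of k w ⟶ Free.of k z) = emb c ≫ emb d :=
  (Free.embedding k D).map_comp c d

lemma hom_induction {y z : D} {motive : (Free.of k y ⟶ Free.of k z) → Prop} (zero : motive 0)
    (add : ∀ f g, motive f → motive g → motive (f + g))
    (smul_emb : ∀ (a : k) (c : y ⟶ z), motive (a • emb c)) (f : Free.of k y ⟶ Free.of k z) :
    motive f := by
  refine Finsupp.induction_linear (motive := motive) f zero add fun c a ↦ ?_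
  have := smul_emb a c
  have h : a • (emb c : Free.of k y ⟶ Free.of k z) =
      (Finsupp.single c a : (y ⟶ z) →₀ k) :=
    Finsupp.smul_single_one c a
  rwa [h] at this

variable {M N P T : Free k D ⥤ ModuleCat.{u} k}

lemma naturality_apply (α : M ⟶ N) {y z : Free k D} (f : y ⟶ z) (v : M.obj y) :
    (α.app z).hom ((M.map f).hom v) = (N.map f).hom ((α.app y).hom v) := by
  rw [← ModuleCat.comp_apply, α.naturality, ModuleCat.comp_apply]

/-- Linear functors on the linearization of a category. -/
structure IsLinearRep (M : Free k D ⥤ ModuleCat.{u} k) : Prop where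
  additive : M.Additive
  linear : M.Linear k

namespace IsLinearRep

variable (hM : IsLinearRep M)
include hM

lemma map_zero_apply {y z : Free k D} (v : M.obj y) : (M.map (0 : y ⟶ z)).hom v = 0 := by
  have := hM.additive
  simp

lemma map_add_apply {y z : Free k D} (f g : y ⟶ z) (v : M.obj y) :
    (M.map (f + g)).hom v = (M.map f).hom v + (M.map g).hom v := by
  have := hM.additive
  simp [M.map_add]

lemma map_smul_apply {y z : Free k D} (a : k) (f : y ⟶ z) (v : M.obj y) :
    (M.map (a • f)).hom v = a • (M.map f).hom v := by
  have := hM.linear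
  simp [M.map_smul]

lemma of_mono (i : N ⟶ M) [Mono i] : IsLinearRep N := by
  have := hM.additive
  have := hM.linear
  exact ⟨⟨fun {y z f g} ↦ by simp [← cancel_mono (i.app z), M.map_add]⟩,
    ⟨fun {y z} f r ↦ by simp [← cancel_mono (i.app z), M.map_smul]⟩⟩

lemma of_epi (p : M ⟶ N) [Epi p] : IsLinearRep N := by
  have := hM.additive
  have := hM.linear
  exact ⟨⟨fun {y z f g} ↦ by
      simp [← cancel_epi (p.app y), ← p.naturality, -NatTrans.naturality, M.map_add]⟩,
    ⟨fun {y z} f r ↦ by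
      simp [← cancel_epi (p.app y), ← p.naturality, -NatTrans.naturality, M.map_smul]⟩⟩

lemma biprod (hN : IsLinearRep N) : IsLinearRep (M ⊞ N) := by
  have := hM.additive
  have := hM.linear
  have := hN.additive
  have := hN.linear
  have key : ∀ {y z : Free k D} (f : y ⟶ z), (M ⊞ N).map f =
      (biprod.fst : M ⊞ N ⟶ M).app y ≫ M.map f ≫ (biprod.inl : M ⟶ M ⊞ N).app z +
      (biprod.snd : M ⊞ N ⟶ N).app y ≫ N.map f ≫ (biprod.inr : N ⟶ M ⊞ N).app z := by
    intro y z f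
    have := NatTrans.congr_app (biprod.total (X := M) (Y := N)) z
    rw [NatTrans.app_add, NatTrans.comp_app, NatTrans.comp_app, NatTrans.id_app] at this
    have h2 := (M ⊞ N).map f ≫= this
    rw [Category.comp_id, Preadditive.comp_add] at h2
    rw [← h2]
    simp
  exact ⟨⟨fun {y z f g} ↦ by rw [key, key, key]; simp [M.map_add, N.map_add]; abel⟩,
    ⟨fun {y z} f r ↦ by rw [key, key]; simp [M.map_smul, N.map_smul]⟩⟩

end IsLinearRep

/-- The functor represented by an object. -/
noncomputable abbrev repr (k : Type u) [Field k] {D : Type u} [Category.{u} D] (x : D) :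
    Free k D ⥤ ModuleCat.{u} k :=
  (linearCoyoneda k (Free k D)).obj (Opposite.op (Free.of k x))

/-- The Yoneda lemma: the morphism from a represented functor attached to an element. -/
noncomputable def ofElement (hM : IsLinearRep M) {x : D} (m : M.obj (Free.of k x)) :
    repr k x ⟶ M where
  app z := ModuleCat.ofHom
    { toFun := fun g ↦ (M.map (X := Free.of k x) g).hom m
      map_add' := fun f g ↦ hM.map_add_apply f g m
      map_smul' := fun a f ↦ hM.map_smul_apply a f m }
  naturality y z f := by
    ext g
    exact congrArg (fun t ↦ (ModuleCat.Hom.hom t) m) (M.map_comp (X := Free.of k x) g f)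

@[simp] lemma ofElement_app (hM : IsLinearRep M) {x : D} (m : M.obj (Free.of k x)) {z : Free k D}
    (g : Free.of k x ⟶ z) : ((ofElement hM m).app z).hom g = (M.map g).hom m := rfl

lemma app_eq_of_ofElement_comp_eq (hM : IsLinearRep M) {x : D} (m : M.obj (Free.of k x))
    {φ : M ⟶ T} {s : repr k x ⟶ T} (h : ofElement hM m ≫ φ = s) :
    (φ.app _).hom m = (s.app (Free.of k x)).hom (𝟙 (Free.of k x)) := by
  rw [← h]
  change _ = (φ.app _).hom ((M.map (𝟙 (Free.of k x))).hom m)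
  rw [M.map_id, ModuleCat.id_apply]

variable {ι : Type} {x : ι → D}

/-- Evaluation of linear combinations of monomials at elements of a functor. -/
noncomputable def ev (m : ∀ i, M.obj (Free.of k (x i))) (z : D) :
    (Monomial x z →₀ k) →ₗ[k] M.obj (Free.of k z) :=
  Finsupp.linearCombination k fun s ↦ (M.map (emb s.2)).hom (m s.1)

@[simp] lemma ev_single (m : ∀ i, M.obj (Free.of k (x i))) (z : D) (s : Monomial x z) (a : k) :
    ev m z (Finsupp.single s a) = a • (M.map (emb s.2)).hom (m s.1) := by
  simp [ev]

lemma ev_act (m : ∀ i, M.obj (Free.of k (x i))) {y z : D} (c : y ⟶ z) (a : Monomial x y →₀ k) :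
    ev m z (Monomial.act k c a) = (M.map (emb c)).hom (ev m y a) := by
  induction a using Finsupp.induction_linear with
  | zero => simp
  | add a b ha hb => simp [ha, hb]
  | single s a => simp [Monomial.push, emb_comp]

lemma app_ev (α : M ⟶ N) (m : ∀ i, M.obj (Free.of k (x i))) (z : D) (a : Monomial x z →₀ k) :
    (α.app (Free.of k z)).hom (ev m z a) = ev (fun i ↦ (α.app _).hom (m i)) z a := by
  induction a using Finsupp.induction_linear with
  | zero => simp
  | add a b ha hb => simp [ha, hb]
  | single s a => rw [ev_single, ev_single, map_smul, naturality_apply]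

lemma ev_comb {κ : Type} {y : κ → D} (m : ∀ i, M.obj (Free.of k (x i)))
    (g : ∀ j, Monomial x (y j) →₀ k) (z : D) (a : Monomial y z →₀ k) :
    ev m z (Monomial.comb g z a) = ev (fun j ↦ ev m (y j) (g j)) z a := by
  induction a using Finsupp.induction_linear with
  | zero => simp
  | add a b ha hb => simp [ha, hb]
  | single s a => simp [ev_act]

/-- `M` is free on the elements `m i`. -/
structure IsFreeOn (M : Free k D ⥤ ModuleCat.{u} k) (m : ∀ i, M.obj (Free.of k (x i))) : Prop where
  isLinearRep : IsLinearRep M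
  bijective : ∀ z, Function.Bijective (ev m z)

namespace IsFreeOn

variable {m : ∀ i, M.obj (Free.of k (x i))} (hM : IsFreeOn M m)
include hM

lemma hom_ext {f g : M ⟶ T} (h : ∀ i, (f.app _).hom (m i) = (g.app _).hom (m i)) : f = g := by
  ext z v
  obtain ⟨a, rfl⟩ := (hM.bijective z).surjective v
  refine (app_ev f m z a).trans (Eq.trans ?_ (app_ev g m z a).symm)
  simp only [h]

/-- The target `T` is not assumed linear, as a coproduct in the category of all functors demands.
The data are therefore morphisms from represented functors rather than elements of `T`. -/
lemma exists_desc (s : ∀ i, repr k (x i) ⟶ T) :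
    ∃ φ : M ⟶ T, ∀ i, ofElement hM.isLinearRep (m i) ≫ φ = s i := by
  let φ : ∀ z : D, M.obj (Free.of k z) →ₗ[k] T.obj (Free.of k z) := fun z ↦
    (Finsupp.linearCombination k fun t : Monomial x z ↦
      ((s t.1).app (Free.of k z)).hom (emb t.2 : Free.of k _ ⟶ Free.of k _)) ∘ₗ
      (LinearEquiv.ofBijective _ (hM.bijective z)).symm.toLinearMap
  have φ_ev : ∀ z (t : Monomial x z), φ z ((M.map (emb t.2)).hom (m t.1)) =
      ((s t.1).app (Free.of k z)).hom (emb t.2 : Free.of k _ ⟶ Free.of k _) := by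
    intro z t
    have : (LinearEquiv.ofBijective _ (hM.bijective z)).symm ((M.map (emb t.2)).hom (m t.1)) =
        Finsupp.single t 1 := by
      rw [LinearEquiv.symm_apply_eq]
      simp
    simp only [φ, LinearMap.comp_apply, LinearEquiv.coe_coe, this,
      Finsupp.linearCombination_single, one_smul]
  have key : ∀ z i (g : Free.of k (x i) ⟶ Free.of k z),
      φ z ((M.map g).hom (m i)) = ((s i).app (Free.of k z)).hom g := by
    intro z i g
    induction g using hom_induction with
    | zero => rw [hM.isLinearRep.map_zero_apply, map_zero]; exact (map_zero _).symm
    | add f g hf hg =>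
      rw [hM.isLinearRep.map_add_apply, map_add, hf, hg]
      exact (map_add _ _ _).symm
    | smul_emb a c =>
      rw [hM.isLinearRep.map_smul_apply, map_smul, φ_ev z ⟨i, c⟩]
      exact (map_smul _ _ _).symm
  have nat : ∀ {y z : D} (f : Free.of k y ⟶ Free.of k z) (v : M.obj (Free.of k y)),
      φ z ((M.map f).hom v) = (T.map f).hom (φ y v) := by
    intro y z f v
    obtain ⟨a, rfl⟩ := (hM.bijective y).surjective v
    induction a using Finsupp.induction_linear with
    | zero => simp
    | add a b ha hb => simp [ha, hb]
    | single t a =>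
      rw [ev_single, map_smul, map_smul, map_smul, map_smul, φ_ev]
      have h1 := key z t.1 (emb t.2 ≫ f)
      rw [M.map_comp, ModuleCat.comp_apply] at h1
      exact congrArg (a • ·) (h1.trans (naturality_apply (s t.1) f _))
  refine ⟨{ app := fun z ↦ ModuleCat.ofHom (φ z), naturality := fun y z f ↦ ?_ }, fun i ↦ ?_⟩
  · ext v
    exact nat f v
  · ext z g
    exact key z i g

lemma exists_hom (hT : IsLinearRep T) (t : ∀ i, T.obj (Free.of k (x i))) :
    ∃ φ : M ⟶ T, ∀ i, (φ.app _).hom (m i) = t i := by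
  obtain ⟨φ, hφ⟩ := hM.exists_desc fun i ↦ ofElement hT (t i)
  refine ⟨φ, fun i ↦ (app_eq_of_ofElement_comp_eq _ _ (hφ i)).trans ?_⟩
  rw [ofElement_app, T.map_id, ModuleCat.id_apply]

/-- A free functor is a direct sum of represented functors. -/
lemma nonempty_isColimit :
    Nonempty (IsColimit (Cofan.mk M fun i ↦ ofElement hM.isLinearRep (m i))) := by
  refine ⟨Cofan.IsColimit.mk _ (fun s ↦ (hM.exists_desc s.inj).choose)
    (fun s j ↦ (hM.exists_desc s.inj).choose_spec j) (fun s φ hφ ↦ ?_)⟩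
  refine hM.hom_ext fun i ↦ ?_
  exact (app_eq_of_ofElement_comp_eq hM.isLinearRep (m i) (hφ i)).trans
    (app_eq_of_ofElement_comp_eq hM.isLinearRep (m i) ((hM.exists_desc s.inj).choose_spec i)).symm

lemma of_iso (e : M ≅ N) : IsFreeOn N fun i ↦ (e.hom.app _).hom (m i) := by
  refine ⟨hM.isLinearRep.of_epi e.hom, fun z ↦ ?_⟩
  have : ⇑(ev (fun i ↦ (e.hom.app _).hom (m i)) z) = (e.hom.app (Free.of k z)).hom ∘ ev m z := by
    ext a
    exact (app_ev e.hom m z a).symm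
  rw [this]
  exact Function.Bijective.comp (ConcreteCategory.bijective_of_isIso (e.hom.app (Free.of k z)))
    (hM.bijective z)

end IsFreeOn

section

variable (k x)

/-- The linear extension of the action of morphisms on linear combinations of monomials. -/
noncomputable def actLinear (y z : D) : (Free.of k y ⟶ Free.of k z) →ₗ[k]
    ((Monomial x y →₀ k) →ₗ[k] (Monomial x z →₀ k)) :=
  show ((y ⟶ z) →₀ k) →ₗ[k] _ from Finsupp.linearCombination k fun c ↦ Monomial.act k c

variable {k}

@[simp] lemma actLinear_emb {y z : D} (c : y ⟶ z) :
    actLinear k x y z (emb c) = Monomial.act k c := by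
  refine (Finsupp.linearCombination_single k (1 : k) c).trans (one_smul _ _)

variable (k)

lemma actLinear_id (z : D) : actLinear k x z z (𝟙 (Free.of k z)) = LinearMap.id := by
  rw [← emb_id, actLinear_emb]
  exact LinearMap.ext (Monomial.act_id k)

lemma actLinear_comp {w y z : D} (f : Free.of k w ⟶ Free.of k y) (g : Free.of k y ⟶ Free.of k z) :
    actLinear k x w z (f ≫ g) = actLinear k x y z g ∘ₗ actLinear k x w y f := by
  induction f using hom_induction with
  | zero => rw [zero_comp, map_zero, map_zero, LinearMap.comp_zero]
  | add f f' hf hf' =>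
    rw [Preadditive.add_comp, map_add, map_add, hf, hf', LinearMap.comp_add]
  | smul_emb a c =>
    rw [Linear.smul_comp, map_smul, map_smul, LinearMap.comp_smul]
    congr 1
    induction g using hom_induction with
    | zero => rw [comp_zero, map_zero, map_zero, LinearMap.zero_comp]
    | add f f' hf hf' =>
      rw [Preadditive.comp_add, map_add, map_add, hf, hf', LinearMap.add_comp]
    | smul_emb b d =>
      rw [Linear.comp_smul, map_smul, map_smul, LinearMap.smul_comp, ← emb_comp]
      congr 1
      simp only [actLinear_emb]
      exact LinearMap.ext (Monomial.act_comp k c d)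

/-- The direct sum of the functors represented by the objects `x i`. -/
noncomputable def freeRep : Free k D ⥤ ModuleCat.{u} k where
  obj z := ModuleCat.of k (Monomial x (show D from z) →₀ k)
  map {y z} f := ModuleCat.ofHom (actLinear k x y z f)
  map_id z := ModuleCat.hom_ext (actLinear_id k x z)
  map_comp f g := ModuleCat.hom_ext (actLinear_comp k x f g)

lemma isLinearRep_freeRep : IsLinearRep (freeRep k x) where
  additive := ⟨fun {y z f g} ↦ ModuleCat.hom_ext (map_add (actLinear k x y z) f g)⟩
  linear := ⟨fun {y z} f a ↦ ModuleCat.hom_ext (map_smul (actLinear k x y z) a f)⟩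

/-- The generators of `freeRep k x`. -/
noncomputable def freeGen (i : ι) : (freeRep k x).obj (Free.of k (x i)) :=
  (Finsupp.single ⟨i, 𝟙 _⟩ 1 : Monomial x (x i) →₀ k)

lemma isFreeOn_freeRep : IsFreeOn (freeRep k x) (freeGen k x) := by
  refine ⟨isLinearRep_freeRep k x, fun z ↦ ?_⟩
  suffices h : ∀ a : Monomial x z →₀ k, ev (freeGen k x) z a = a from
    (funext h : ⇑(ev (freeGen k x) z) = id) ▸ Function.bijective_id
  intro a
  induction a using Finsupp.induction_linear with
  | zero => exact map_zero _
  | add a b ha hb => exact (map_add _ a b).trans (congrArg₂ _ ha hb)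
  | single s a =>
    refine (ev_single _ z s a).trans ?_
    change a • actLinear k x _ _ (emb s.2) _ = _
    rw [actLinear_emb, freeGen, Monomial.act_single]
    simp [Monomial.push]

end

/-- Finite direct sums of represented functors. -/
def IsFiniteFree : ObjectProperty (Free k D ⥤ ModuleCat.{u} k) := fun M ↦
  ∃ (ι : Type) (_ : Finite ι) (x : ι → D) (m : ∀ i, M.obj (Free.of k (x i))), IsFreeOn M m

lemma isFiniteFree_iff : IsFiniteFree M ↔
    ∃ (n : ℕ) (x : Fin n → D), Nonempty (M ≅ ∐ fun i ↦ repr k (x i)) := by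
  constructor
  · rintro ⟨ι, _, x, m, h⟩
    obtain ⟨n, ⟨e⟩⟩ := Finite.exists_equiv_fin ι
    obtain ⟨hc⟩ := h.nonempty_isColimit
    exact ⟨n, x ∘ e.symm, ⟨hc.coconePointUniqueUpToIso (coproductIsCoproduct _) ≪≫
      (Sigma.reindex e.symm fun i ↦ repr k (x i)).symm⟩⟩
  · rintro ⟨n, x, ⟨e⟩⟩
    obtain ⟨hc⟩ := (isFreeOn_freeRep k x).nonempty_isColimit
    exact ⟨Fin n, inferInstance, x, _, (isFreeOn_freeRep k x).of_iso
      (hc.coconePointUniqueUpToIso (coproductIsCoproduct _) ≪≫ e.symm)⟩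

namespace IsFiniteFree

lemma isLinearRep (hM : IsFiniteFree M) : IsLinearRep M := by
  obtain ⟨_, _, _, _, h⟩ := hM
  exact h.isLinearRep

lemma exists_lift (f : P ⟶ N) (p : M ⟶ N) (hP : IsFiniteFree P) (hM : IsLinearRep M)
    (hp : Epi p) : ∃ f', f' ≫ p = f := by
  obtain ⟨ι, _, x, m, h⟩ := hP
  have hsurj : ∀ z, Function.Surjective (p.app z).hom := fun z ↦
    (ModuleCat.epi_iff_surjective _).1 inferInstance
  choose t ht using fun i ↦ hsurj _ ((f.app _).hom (m i))
  obtain ⟨f', hf'⟩ := h.exists_hom hM t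
  refine ⟨f', h.hom_ext fun i ↦ ?_⟩
  rw [NatTrans.comp_app, ModuleCat.hom_comp, LinearMap.comp_apply, hf', ht]

lemma biprod (hM : IsFiniteFree M) (hN : IsFiniteFree N) : IsFiniteFree (M ⊞ N) := by
  obtain ⟨ι, _, x, m, h⟩ := hM
  obtain ⟨ι', _, x', m', h'⟩ := hN
  let y : ι ⊕ ι' → D := Sum.elim x x'
  have hF := isFreeOn_freeRep k y
  obtain ⟨φ, hφ⟩ := hF.exists_hom (h.isLinearRep.biprod h'.isLinearRep)
    (Sum.rec (fun i ↦ ((biprod.inl : M ⟶ M ⊞ N).app _).hom (m i))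
      (fun i ↦ ((biprod.inr : N ⟶ M ⊞ N).app _).hom (m' i)))
  obtain ⟨ψ, hψ⟩ := h.exists_hom hF.isLinearRep
    fun i ↦ (freeGen k y (.inl i))
  obtain ⟨ψ', hψ'⟩ := h'.exists_hom hF.isLinearRep
    fun i ↦ (freeGen k y (.inr i))
  have hφl : ∀ i, ((biprod.inl : M ⟶ M ⊞ N).app _).hom (m i) = (φ.app (Free.of k (x i))).hom
      (freeGen k y (.inl i)) := fun i ↦ (hφ (.inl i)).symm
  have hφr : ∀ i, ((biprod.inr : N ⟶ M ⊞ N).app _).hom (m' i) = (φ.app (Free.of k (x' i))).hom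
      (freeGen k y (.inr i)) := fun i ↦ (hφ (.inr i)).symm
  have hl : ψ ≫ φ = biprod.inl := h.hom_ext fun i ↦ by
    rw [NatTrans.comp_app, ModuleCat.hom_comp, LinearMap.comp_apply, hψ, hφl]
  have hr : ψ' ≫ φ = biprod.inr := h'.hom_ext fun i ↦ by
    rw [NatTrans.comp_app, ModuleCat.hom_comp, LinearMap.comp_apply, hψ', hφr]
  let e : freeRep k y ≅ M ⊞ N :=
    { hom := φ
      inv := biprod.desc ψ ψ'
      hom_inv_id := by
        refine hF.hom_ext ?_
        rintro (i | i)
        · rw [NatTrans.comp_app, ModuleCat.hom_comp, LinearMap.comp_apply, hφ]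
          refine Eq.trans ?_ (hψ i)
          exact congrArg (fun α ↦ (α.app _).hom (m i)) (biprod.inl_desc ψ ψ')
        · rw [NatTrans.comp_app, ModuleCat.hom_comp, LinearMap.comp_apply, hφ]
          refine Eq.trans ?_ (hψ' i)
          exact congrArg (fun α ↦ (α.app _).hom (m' i)) (biprod.inr_desc ψ ψ')
      inv_hom_id := by
        apply biprod.hom_ext'
        · simp [hl]
        · simp [hr] }
  exact ⟨ι ⊕ ι', inferInstance, y, _, hF.of_iso e⟩

/-- The image of a morphism between finite free functors is finite free, over a left cancellative
category in which two morphisms with a common multiple are comparable for divisibility, and whose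
monomials are well-ordered compatibly with composition. -/
lemma image
    (cancel : ∀ {a b c : D} (f : a ⟶ b) (g g' : b ⟶ c), f ≫ g = f ≫ g' → g = g')
    (rigid : ∀ {a b b' c : D} (f : a ⟶ b) (f' : a ⟶ b') (g : b ⟶ c) (g' : b' ⟶ c),
      f ≫ g = f' ≫ g' → (∃ d, f ≫ d = f') ∨ (∃ d, f' ≫ d = f))
    (order : ∀ {ι : Type} (x : ι → D), ∃ (W : Type u) (_ : LinearOrder W) (_ : WellFoundedLT W),
      Nonempty (Monomial.AdmissibleOrder x W))
    (p : P ⟶ M) (i : M ⟶ N) (hp : Epi p) (hi : Mono i) (hP : IsFiniteFree P)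
    (hN : IsFiniteFree N) : IsFiniteFree M := by
  obtain ⟨κ, _, y, q, hq⟩ := hP
  obtain ⟨ι, _, x, m, hm⟩ := hN
  obtain ⟨W, _, _, ⟨o⟩⟩ := order x
  have hsurj : ∀ z, Function.Surjective (p.app z).hom := fun z ↦
    (ModuleCat.epi_iff_surjective _).1 inferInstance
  have hinj : ∀ z, Function.Injective (i.app z).hom := fun z ↦
    (ModuleCat.mono_iff_injective _).1 inferInstance
  -- Coordinates in `N` of the images of the generators of `P`; they generate the image `M`.
  choose g hg using fun j ↦ (hm.bijective (y j)).surjective (((p ≫ i).app _).hom (q j))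
  obtain ⟨h, hr, hfree⟩ := o.exists_free_generators cancel rigid g
  have hrange : ∀ z (v : M.obj (Free.of k z)), ∃ a ∈ LinearMap.range (Monomial.comb h z),
      ev m z a = (i.app _).hom v := by
    intro z v
    obtain ⟨w, rfl⟩ := hsurj _ v
    obtain ⟨b, rfl⟩ := (hq.bijective z).surjective w
    refine ⟨Monomial.comb g z b, hr z ▸ ⟨b, rfl⟩, ?_⟩
    rw [ev_comb]
    simp only [hg]
    exact (app_ev (p ≫ i) q z b).symm
  have hmem : ∀ z, ∀ a ∈ LinearMap.range (Monomial.comb h z), ∃ v : M.obj (Free.of k z),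
      (i.app _).hom v = ev m z a := by
    intro z a ha
    rw [hr z] at ha
    obtain ⟨b, rfl⟩ := ha
    refine ⟨(p.app _).hom (ev q z b), ?_⟩
    rw [ev_comb]
    simp only [hg]
    exact app_ev (p ≫ i) q z b
  -- The nonzero members of the reduced family come from elements of `M`, which form its basis.
  choose t ht using fun j : {j // h j ≠ 0} ↦ hmem (y j) (h j) (by
    have := Monomial.act_mem_range_comb (k := k) h j.1 (𝟙 _)
    rwa [Monomial.act_id] at this)
  have hev : ∀ z a, (i.app _).hom (ev t z a) =
      ev m z (Monomial.comb (fun j : {j // h j ≠ 0} ↦ h j) z a) := by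
    intro z a
    rw [ev_comb, app_ev]
    simp only [ht]
  refine ⟨{j // h j ≠ 0}, inferInstance, fun j ↦ y j, t, hm.isLinearRep.of_mono i,
    fun z ↦ ⟨fun a b hab ↦ ?_, fun v ↦ ?_⟩⟩
  · apply hfree z
    apply (hm.bijective z).injective
    rw [← hev, ← hev, hab]
  · obtain ⟨a, ha, hav⟩ := hrange z v
    rw [← Monomial.range_comb_subtype_ne_zero] at ha
    obtain ⟨b, rfl⟩ := ha
    exact ⟨b, hinj _ (by rw [hev, hav])⟩

end IsFiniteFree

end CategoryTheory.Free

/-! ### Finitely presented representations of a thread quiver -/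

lemma CategoryTheory.ShortComplex.Exact.exists_exact_of_iso {C : Type*} [Category* C] [Abelian C]
    {P₁ P₀ M P₁' P₀' M' : C} {f : P₁ ⟶ P₀} {g : P₀ ⟶ M} {w : f ≫ g = 0}
    (he : (ShortComplex.mk f g w).Exact) (hg : Epi g) (e₁ : P₁ ≅ P₁') (e₀ : P₀ ≅ P₀')
    (e : M ≅ M') :
    ∃ (f' : P₁' ⟶ P₀') (g' : P₀' ⟶ M') (w' : f' ≫ g' = 0),
      (ShortComplex.mk f' g' w').Exact ∧ Epi g' := by
  have hepi : Epi (g ≫ e.hom) := epi_comp _ _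
  refine ⟨e₁.inv ≫ f ≫ e₀.hom, e₀.inv ≫ g ≫ e.hom, by simp [reassoc_of% w], ?_, epi_comp _ _⟩
  let i : ShortComplex.mk f g w ≅ ShortComplex.mk (e₁.inv ≫ f ≫ e₀.hom) (e₀.inv ≫ g ≫ e.hom)
      (by simp [reassoc_of% w]) := ShortComplex.isoMk e₁ e₀ e (by simp) (by simp)
  exact ShortComplex.exact_of_iso i he

namespace ThreadQuiver

open CategoryTheory.Free

variable {V : Type u} [Quiver.{u} V] (T : ThreadQuiver V) (k : Type u) [Field k]

lemma isRep_iff (M : T.PathCat k ⥤ ModuleCat.{u} k) : T.isRep k M ↔ IsLinearRep M :=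
  ⟨fun h ↦ ⟨h.1, h.2⟩, fun h ↦ ⟨h.1, h.2⟩⟩

/-- The path category of a thread quiver is semihereditary. -/
lemma isSemihereditary : ObjectProperty.IsSemihereditary (T.isRep k)
    (IsFiniteFree : ObjectProperty (T.PathCat k ⥤ ModuleCat.{u} k)) where
  quotient M N p _ hM := (T.isRep_iff k N).2 (((T.isRep_iff k M).1 hM).of_epi p)
  le P hP := (T.isRep_iff k P).2 hP.isLinearRep
  exists_lift _ M _ f p hP hM hp := hP.exists_lift f p ((T.isRep_iff k M).1 hM) hp
  biprod _ _ hP hP' := hP.biprod hP'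
  image _ _ _ p i hp hi hP hP' := IsFiniteFree.image Point.comp_left_cancel Point.rigid
    Point.exists_admissibleOrder p i hp hi hP hP'

lemma isFinitelyPresented_iff (M : T.PathCat k ⥤ ModuleCat.{u} k) :
    T.IsFinitelyPresented k M ↔
      (IsFiniteFree : ObjectProperty (T.PathCat k ⥤ ModuleCat.{u} k)).HasPresentation M := by
  constructor
  · rintro ⟨m, n, x, y, f, g, w, h⟩
    exact ⟨_, _, f, g, w, isFiniteFree_iff.2 ⟨n, y, ⟨Iso.refl _⟩⟩,
      isFiniteFree_iff.2 ⟨m, x, ⟨Iso.refl _⟩⟩, h⟩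
  · rintro ⟨P₁, P₀, f, g, w, h₁, h₀, he, hg⟩
    obtain ⟨n, y, ⟨e₁⟩⟩ := isFiniteFree_iff.1 h₁
    obtain ⟨m, x, ⟨e₀⟩⟩ := isFiniteFree_iff.1 h₀
    exact ⟨m, n, x, y, he.exists_exact_of_iso hg e₁ e₀ (Iso.refl _)⟩

/-- Pointwise finite-dimensional functors. -/
def IsPointwiseFinite : ObjectProperty (T.PathCat k ⥤ ModuleCat.{u} k) :=
  fun M ↦ ∀ x, FiniteDimensional k (M.obj x)

variable {T k}

/-- Linearity is automatic for a quotient of a free functor. -/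
lemma isRepFp_iff {M : T.PathCat k ⥤ ModuleCat.{u} k} :
    T.isRepFp k M ↔ T.IsPointwiseFinite k M ∧
      (IsFiniteFree : ObjectProperty (T.PathCat k ⥤ ModuleCat.{u} k)).HasPresentation M := by
  rw [← isFinitelyPresented_iff]
  refine ⟨fun h ↦ ⟨h.1.2, h.2⟩, fun h ↦ ⟨⟨?_, h.1⟩, h.2⟩⟩
  exact (T.isSemihereditary k).prop_of_hasPresentation ((T.isFinitelyPresented_iff k M).1 h.2)

variable {M N : T.PathCat k ⥤ ModuleCat.{u} k}

lemma IsPointwiseFinite.of_mono (hM : T.IsPointwiseFinite k M) (i : N ⟶ M) [Mono i] :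
    T.IsPointwiseFinite k N := fun x ↦
  have := hM x
  Module.Finite.of_injective (i.app x).hom ((ModuleCat.mono_iff_injective _).1 inferInstance)

lemma IsPointwiseFinite.of_epi (hM : T.IsPointwiseFinite k M) (p : M ⟶ N) [Epi p] :
    T.IsPointwiseFinite k N := fun x ↦
  have := hM x
  Module.Finite.of_surjective (p.app x).hom ((ModuleCat.epi_iff_surjective _).1 inferInstance)

lemma IsPointwiseFinite.of_shortExact {S : ShortComplex (T.PathCat k ⥤ ModuleCat.{u} k)}
    (hS : S.ShortExact) (h₁ : T.IsPointwiseFinite k S.X₁) (h₃ : T.IsPointwiseFinite k S.X₃) :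
    T.IsPointwiseFinite k S.X₂ := fun x ↦ by
  have := h₁ x
  have := h₃ x
  have h := (ShortComplex.ShortExact.moduleCat_exact_iff_function_exact _).1
    (hS.map_of_exact ((evaluation _ _).obj x)).exact
  have hker : LinearMap.ker (S.g.app x).hom = LinearMap.range (S.f.app x).hom :=
    LinearMap.exact_iff.1 h
  have : Module.Finite k (LinearMap.ker (S.g.app x).hom) := by
    rw [hker]
    infer_instance
  have : Module.Finite k (S.X₂.obj x ⧸ LinearMap.ker (S.g.app x).hom) :=
    Module.Finite.equiv
      (LinearMap.quotKerEquivRange (S.g.app x).hom).symm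
  exact Module.Finite.of_submodule_quotient (LinearMap.ker (S.g.app x).hom)

/-- Finitely presented representations are closed under extensions. -/
lemma isRepFp_of_shortExact {S : ShortComplex (T.PathCat k ⥤ ModuleCat.{u} k)}
    (hS : S.ShortExact) (h₂ : T.isRep k S.X₂) (h₁ : T.isRepFp k S.X₁) (h₃ : T.isRepFp k S.X₃) :
    T.isRepFp k S.X₂ := by
  rw [isRepFp_iff] at h₁ h₃ ⊢
  exact ⟨.of_shortExact hS h₁.1 h₃.1,
    (T.isSemihereditary k).hasPresentation_of_shortExact hS h₂ h₁.2 h₃.2⟩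

/-- Together with closure under cokernels and finite products, this makes the full subcategory
abelian with exact inclusion. -/
instance : (T.isRepFp k).IsClosedUnderKernels where
  kernels_le := by
    rintro _ ⟨f, c, hc, hM, hN⟩
    have : Mono c.ι := Fork.IsLimit.mono hc
    rw [isRepFp_iff] at hM hN ⊢
    exact ⟨hM.1.of_mono c.ι, (T.isSemihereditary k).hasPresentation_of_kernel c.ι f c.condition
      this (ShortComplex.exact_of_f_is_kernel _
        (IsLimit.ofIsoLimit hc (Fork.ext (Iso.refl _) (by simp)))) hM.2 hN.2⟩

instance : (T.isRepFp k).IsClosedUnderCokernels where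
  cokernels_le := by
    rintro _ ⟨f, c, hc, hM, hN⟩
    have : Epi c.π := Cofork.IsColimit.epi hc
    rw [isRepFp_iff] at hM hN ⊢
    exact ⟨hN.1.of_epi c.π, (T.isSemihereditary k).hasPresentation_of_cokernel f c.π c.condition
      this (ShortComplex.exact_of_g_is_cokernel _
        (IsColimit.ofIsoColimit hc (Cofork.ext (Iso.refl _) (by simp)))) hM.2 hN.2⟩

lemma isRepFp_of_iso (e : M ≅ N) (hM : T.isRepFp k M) : T.isRepFp k N := by
  rw [isRepFp_iff] at hM ⊢
  obtain ⟨h, P₁, P₀, f, g, w, h₁, h₀, he, hg⟩ := hM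
  obtain ⟨f', g', w', he'⟩ := he.exists_exact_of_iso hg (Iso.refl _) (Iso.refl _) e
  exact ⟨h.of_epi e.hom, P₁, P₀, f', g', w', h₁, h₀, he'⟩

instance : (T.isRepFp k).IsClosedUnderIsomorphisms where
  of_iso := isRepFp_of_iso

lemma isRepFp_biprod (hM : T.isRepFp k M) (hN : T.isRepFp k N) : T.isRepFp k (M ⊞ N) := by
  rw [isRepFp_iff] at hM hN ⊢
  exact ⟨.of_shortExact (ShortComplex.Splitting.ofHasBinaryBiproduct M N).shortExact hM.1 hN.1,
    (T.isSemihereditary k).hasPresentation_biprod hM.2 hN.2⟩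

instance : (T.isRepFp k).ContainsZero where
  exists_zero := by
    let x : PEmpty.{1} → T.Point := fun i ↦ i.elim
    refine ⟨freeRep k x, ?_, ?_⟩
    · rw [IsZero.iff_id_eq_zero]
      exact (isFreeOn_freeRep k x).hom_ext fun i ↦ i.elim
    · rw [isRepFp_iff]
      refine ⟨fun z ↦ ?_, ObjectProperty.hasPresentation_of_prop
        ⟨PEmpty, inferInstance, x, _, isFreeOn_freeRep k x⟩⟩
      have : IsEmpty (Monomial x (show T.Point from z)) := ⟨fun s ↦ s.1.elim⟩
      exact inferInstanceAs (Module.Finite k (Monomial x (show T.Point from z) →₀ k))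

instance : (T.isRepFp k).IsClosedUnderBinaryProducts where
  limitsOfShape_le := by
    rintro M ⟨p⟩
    refine isRepFp_of_iso (IsLimit.conePointUniqueUpToIso (BinaryBiproduct.isLimit _ _)
      ((IsLimit.postcomposeHomEquiv (diagramIsoPair p.diag) _).symm p.isLimit))
      (isRepFp_biprod (p.prop_diag_obj _) (p.prop_diag_obj _))

instance : (T.isRepFp k).IsClosedUnderFiniteProducts := .mk'

instance : PreservesFiniteLimits (T.isRepFp k).ι :=
  have := (T.isRepFp k).preservesKernels_ι
  (T.isRepFp k).ι.preservesFiniteLimits_of_preservesKernels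

instance : PreservesFiniteColimits (T.isRepFp k).ι :=
  have := (T.isRepFp k).preservesCokernels_ι
  (T.isRepFp k).ι.preservesFiniteColimits_of_preservesCokernels

/-- Extensions of finitely presented representations lift along epimorphisms. -/
lemma liftsExtensions (X : T.RepFp k) : LiftsExtensions X := by
  intro K X' f g w hS K' q hq
  have hS' := hS.map_of_exact (T.isRepFp k).ι
  -- The lift is built among all functors, where the resolution of `X` lives; `W` is pointwise
  -- finite and finitely presented as an extension of `X` by `K'`.
  obtain ⟨W, f', g', w', r, hW, hT, h₁, h₂⟩ := (T.isSemihereditary k).exists_shortExact_of_epi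
    f.hom g.hom _ hS' ((T.isRepFp k).ι.map q) inferInstance (isRepFp_iff.1 X.property).2
    X'.property.1.1 K'.property.1.1 (fun M N hM hN ↦ (T.isRep_iff k _).2
      (((T.isRep_iff k M).1 hM).biprod ((T.isRep_iff k N).1 hN)))
  let W' : T.RepFp k := ⟨W, isRepFp_of_shortExact hT hW K'.property X.property⟩
  have hw : (ObjectProperty.homMk f' : K' ⟶ W') ≫ (ObjectProperty.homMk g' : W' ⟶ X) = 0 :=
    (T.isRepFp k).ι.map_injective w'
  have hT' : (ShortComplex.mk (ObjectProperty.homMk f' : K' ⟶ W')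
      (ObjectProperty.homMk g' : W' ⟶ X) hw).map (T.isRepFp k).ι = ShortComplex.mk f' g' w' := rfl
  refine ⟨W', ObjectProperty.homMk f', ObjectProperty.homMk g', hw, ObjectProperty.homMk r,
    { exact := ?_, mono_f := ?_, epi_g := ?_ }, (T.isRepFp k).ι.map_injective h₁,
    (T.isRepFp k).ι.map_injective h₂⟩
  · rw [← ShortComplex.exact_map_iff_of_faithful _ (T.isRepFp k).ι, hT']
    exact hT.exact
  · exact (T.isRepFp k).ι.mono_of_mono_map hT.mono_f
  · exact (T.isRepFp k).ι.epi_of_epi_map hT.epi_g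

end ThreadQuiver

theorem mainTheorem9 {V : Type u} [Quiver.{u} V] (T : ThreadQuiver V) (k : Type u) [Field k]
    (hT : T.IsLeftQBounded k) :
    (∃ a : Abelian (T.RepFp k),
      a.toPreadditive = (inferInstance : Preadditive (T.RepFp k)) ∧
      IsHereditaryCategory (T.RepFp k)) ∧
    (∀ S : ShortComplex (T.PathCat k ⥤ ModuleCat.{u} k), S.ShortExact → T.isRep k S.X₂ →
      T.isRepFp k S.X₁ → T.isRepFp k S.X₃ → T.isRepFp k S.X₂) :=
  ⟨⟨inferInstance, rfl, hasProjectiveDimensionLE_one_of_liftsExtensions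
    ThreadQuiver.liftsExtensions⟩, fun _ hS h₂ h₁ h₃ ↦
    ThreadQuiver.isRepFp_of_shortExact hS h₂ h₁ h₃⟩
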